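/- Let $\mathbb K=\mathbb R$ or $\mathbb C$ (smooth means holomorphic if $\mathbb K=\mathbb C$), let $\mathfrak g$ be a Lie algebra of matrices over $\mathbb K$ on which the trace form $(V,W)\mapsto\mathrm{Tr}(VW)$ is nondegenerate, let $A\in\mathfrak g$ and $n\ge 0$. On $$\mathcal M_A=\Big\{X(\lambda)=\lambda^{n+1}A+\sum_{i=0}^{n}\lambda^iX_i \;\Big|\; X_i\in\mathfrak g\Big\}\cong\mathfrak g^{n+1},$$ with tangent and cotangent spaces identified with $\mathfrak g^{n+1}$ by means of the pairing $\langle V,W\rangle=\sum_i\mathrm{Tr}(V_iW_i)$, consider the compatible Poisson tensors $$(P_0W)_i=\sum_{j=0}^{n}[X_{i+j+1},W_j],\qquad (P_1W)_0=-[X_0,W_0],\quad (P_1W)_i=\sum_{j=1}^{n}[X_{i+j},W_j]\ (i\ge1),$$ where $X_{n+1}=A$ and $X_l=0$ for $l>n+1$, the pencil $P_\lambda=P_1-\lambda P_0$, and the brackets $\{F,G\}_\lambda=\langle dF,P_\lambda\,dG\rangle$. Let $\mathcal S$ be a symplectic leaf of $P_0$ (with its immersed manifold structure), let $D=P_1(\mathrm{Ker}\,P_0)$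 and $E=D\cap T\mathcal S$. Assume that $D$ has constant rank along $\mathcal S$ and that the space of leaves $\mathcal N=\mathcal S/E$ is a quotient manifold, i.e. $\pi:\mathcal S\to\mathcal N$ is a surjective submersion with connected fibres and $\mathrm{Ker}\,d\pi=E$. The reduced bracket $\{f,h\}_\lambda$ of functions on $\mathcal N$ is the function on $\mathcal N$ whose pull-back to $\mathcal S$ is $\{F,H\}_\lambda|_{\mathcal S}$, where $F,H$ are any local prolongations of $f,h$: functions on $\mathcal M_A$ that restrict to $f\circ\pi$, $h\circ\pi$ on $\mathcal S$ and whose differentials annihilate $D$ along $\mathcal S$. The Hamiltonian vector field $Y_\lambda$ on $\mathcal N$ of a function $f_\lambda$ is determined by $Y_\lambda(h)=\{h,f_\lambda\}_\lambda$ for all local smooth functions $h$. Let $\mathcal Q\subset\mathcal S$ be a submanifold transversal to $E$, that is, $T_q\mathcal S=T_q\mathcal Q\oplus E_q$ for all $q\in\mathcal Q$. Let $f_\lambda=\sum_{l=0}^{m}\lambda^lf_l$, with smooth functions $f_l$ on $\mathcal N$ (for instance a single function, $m=0$), and for every $\lambda\in\mathbb K$ let $Y_\lambda$ be the Hamiltonian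 vector field on $\mathcal N$, with Hamiltonian $f_\lambda$, of the reduced pencil at $\lambda$. Then for every $\lambda$ there is a unique vector field $V_\lambda$ on $\mathcal Q$ that represents $Y_\lambda$, i.e. $d(\pi|_{\mathcal Q})V_\lambda=Y_\lambda\circ\pi|_{\mathcal Q}$, and these vector fields admit a Lax representation on $\mathcal Q$: there are functions $B_0,\dots,B_{m+1}:\mathcal Q\to\mathfrak g$, of class $C^\infty$ in the real sense, such that with $L(\lambda)=\sum_{l=0}^{m+1}\lambda^lB_l$ one has, for every $\lambda\in\mathbb K$ and at every point $X(\lambda)$ of $\mathcal Q$, $$\frac{\partial X(\lambda)}{\partial t_\lambda}=[L(\lambda),X(\lambda)],$$ where $\partial X(\lambda)/\partial t_\lambda=\sum_{i=0}^n\lambda^iV_i$ for $V_\lambda=(V_0,\dots,V_n)$. Moreover, every point of $\mathcal Q$ has a neighbourhood on which the functions $B_l$ in such a representation can be chosen smooth over $\mathbb K$ (holomorphic if $\mathbb K=\mathbb C$). -/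

import Mathlib

open scoped Manifold ContDiff Topology

-- The commutator bracket on matrices, and a norm on them (which one does not matter).
attribute [local instance] LieRing.ofAssociativeRing Matrix.normedAddCommGroup Matrix.normedSpace

namespace MatrixPencil

/-- The usual topology of matrices, in the form in which it is given by the norm. -/
abbrev matrixTopology {𝕜 : Type*} [RCLike 𝕜] {p : ℕ} :
    TopologicalSpace (Matrix (Fin p) (Fin p) 𝕜) :=
  (Matrix.normedAddCommGroup :
    NormedAddCommGroup (Matrix (Fin p) (Fin p) 𝕜)).toPseudoMetricSpace.toUniformSpace.toTopologicalSpace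

end MatrixPencil

attribute [local instance] MatrixPencil.matrixTopology

namespace MatrixPencil

section Algebra

variable {𝕜 : Type*} [RCLike 𝕜] {p n : ℕ} {g : LieSubalgebra 𝕜 (Matrix (Fin p) (Fin p) 𝕜)}

/-- The space `⨁_{i=0}^{n} g` of tuples `(X_0, …, X_n)`. Such a tuple stands for the matrix
polynomial `λ^(n+1) A + ∑ λ^i X_i`; tangent vectors and covectors are tuples as well. -/
abbrev Phase (g : LieSubalgebra 𝕜 (Matrix (Fin p) (Fin p) 𝕜)) (n : ℕ) : Type _ :=
  Fin (n + 1) → g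

/-- The bilinear form `(V, W) ↦ Tr (V W)` on `g` is nondegenerate. -/
def TraceNondegenerate (g : LieSubalgebra 𝕜 (Matrix (Fin p) (Fin p) 𝕜)) : Prop :=
  ∀ V : g, (∀ W : g, Matrix.trace (V.1 * W.1) = 0) → V = 0

/-- The pairing `⟨V, W⟩ = ∑ Tr (V_i W_i)`. -/
def pairing (V W : Phase g n) : 𝕜 :=
  ∑ i, Matrix.trace ((V i).1 * (W i).1)

/-- The coefficient of `λ^k` in `λ^(n+1) A + ∑ λ^i X_i`. -/
def coeff (A : g) (X : Phase g n) (k : ℕ) : g :=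
  if h : k < n + 1 then X ⟨k, h⟩ else if k = n + 1 then A else 0

/-- The value at `z` of the matrix polynomial `λ^(n+1) A + ∑ λ^i X_i`. -/
def laxMatrix (A : g) (X : Phase g n) (z : 𝕜) : g :=
  z ^ (n + 1) • A + ∑ i : Fin (n + 1), z ^ (i : ℕ) • X i

/-- The value at `z` of the polynomial `∑ λ^i V_i` represented by a tangent vector. -/
def evalTangent (V : Phase g n) (z : 𝕜) : g :=
  ∑ i : Fin (n + 1), z ^ (i : ℕ) • V i

/-- The Poisson tensor `P_0`: the entry `(i, j)` of its matrix is `[X_{i+j+1}, ·]`, where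
`X_{n+1} = A` and `X_k = 0` for `k > n + 1`. -/
noncomputable def P0 (A : g) (X : Phase g n) : Phase g n →ₗ[𝕜] Phase g n :=
  LinearMap.pi fun i => ∑ j : Fin (n + 1),
    (LieAlgebra.ad 𝕜 g (coeff A X (i + j + 1)) : g →ₗ[𝕜] g) ∘ₗ LinearMap.proj j

/-- The Poisson tensor `P_1`: the entry `(0, 0)` of its matrix is `-[X_0, ·]`, the entry `(i, j)`
is `[X_{i+j}, ·]` for `i, j ≥ 1`, and the remaining ones vanish. -/
noncomputable def P1 (A : g) (X : Phase g n) : Phase g n →ₗ[𝕜] Phase g n :=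
  LinearMap.pi fun i => ∑ j : Fin (n + 1),
    (if i = 0 ∧ j = 0 then -(LieAlgebra.ad 𝕜 g (X 0) : g →ₗ[𝕜] g)
      else if i = 0 ∨ j = 0 then 0
      else (LieAlgebra.ad 𝕜 g (coeff A X (i + j)) : g →ₗ[𝕜] g)) ∘ₗ LinearMap.proj j

/-- The Poisson pencil `P_z = P_1 - z P_0`. -/
noncomputable def pencil (A : g) (z : 𝕜) (X : Phase g n) : Phase g n →ₗ[𝕜] Phase g n :=
  P1 A X - z • P0 A X

/-- The differential of `F` at `X`, as a tuple `(∂F/∂X_0, …, ∂F/∂X_n)` through the pairing. (It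
exists and is unique if the trace form is nondegenerate.) -/
noncomputable def gradient (F : Phase g n → 𝕜) (X : Phase g n) : Phase g n :=
  Classical.epsilon fun W => ∀ V, fderiv 𝕜 F X V = pairing W V

/-- The Poisson bracket `{F, G}_z = ⟨dF, P_z dG⟩`. -/
noncomputable def bracket (A : g) (z : 𝕜) (F G : Phase g n → 𝕜) (X : Phase g n) : 𝕜 :=
  pairing (gradient F X) (pencil A z X (gradient G X))

/-- `D = P_1 (Ker P_0)` at the point `X`. -/
noncomputable def distD (A : g) (X : Phase g n) : Submodule 𝕜 (Phase g n) :=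
  (LinearMap.ker (P0 A X)).map (P1 A X)

/-- `Y` is the time-one value of an integral curve, starting at `X`, of a Hamiltonian vector
field `P_0 dH`. -/
def HamiltonianStep (A : g) (X Y : Phase g n) : Prop :=
  ∃ H : Phase g n → 𝕜, ContDiff 𝕜 ∞ H ∧ ∃ γ : ℝ → Phase g n, γ 0 = X ∧ γ 1 = Y ∧
    ∀ t ∈ Set.Icc (0 : ℝ) 1,
      HasDerivWithinAt γ (P0 A (γ t) (gradient H (γ t))) (Set.Icc (0 : ℝ) 1) t

/-- The symplectic leaf of `P_0` through `X`, as a set: all points that can be reached from `X`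
along integral curves of Hamiltonian vector fields. -/
def symplecticLeaf (A : g) (X : Phase g n) : Set (Phase g n) :=
  {Y | Relation.ReflTransGen (HamiltonianStep A) X Y}

end Algebra

section Geometry

variable {𝕜 : Type*} [RCLike 𝕜] {p n r k d : ℕ}
  {g : LieSubalgebra 𝕜 (Matrix (Fin p) (Fin p) 𝕜)}
  {S : Type*} [TopologicalSpace S] [ChartedSpace (Fin r → 𝕜) S]
  {N : Type*} [TopologicalSpace N] [ChartedSpace (Fin k → 𝕜) N]
  {Q : Type*} [TopologicalSpace Q] [ChartedSpace (Fin d → 𝕜) Q]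

/-- The differential at `s` of a map `φ` from a manifold to the phase space. -/
noncomputable def dPhase (φ : S → Phase g n) (s : S) :
    TangentSpace 𝓘(𝕜, Fin r → 𝕜) s →L[𝕜] Phase g n :=
  mfderiv 𝓘(𝕜, Fin r → 𝕜) 𝓘(𝕜, Phase g n) φ s

/-- The manifold `S`, immersed by `ι`, is a symplectic leaf of `P_0` with its immersed manifold
structure, whose tangent spaces are the images of `P_0`. -/
structure IsSymplecticLeaf (A : g) (ι : S → Phase g n) : Prop where
  connected : ConnectedSpace S
  smooth : ContMDiff 𝓘(𝕜, Fin r → 𝕜) 𝓘(𝕜, Phase g n) ∞ ι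
  injective : Function.Injective ι
  range_eq : ∃ X, Set.range ι = symplecticLeaf A X
  immersion : ∀ s, Function.Injective (dPhase (r := r) ι s)
  tangent : ∀ s, LinearMap.range (dPhase (r := r) ι s).toLinearMap = LinearMap.range (P0 A (ι s))

/-- The distribution `E = D ∩ TS` on the leaf `S`, as a subspace of the tangent space `T_s S`. -/
noncomputable def distE (A : g) (ι : S → Phase g n) (s : S) :
    Submodule 𝕜 (TangentSpace 𝓘(𝕜, Fin r → 𝕜) s) :=
  (distD A (ι s)).comap (dPhase ι s).toLinearMap

/-- `π : S → N` exhibits the manifold `N` as the quotient `S / E`: it is a surjective submersion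
whose fibres are the leaves of `E` (connected, with tangent spaces given by `E`). -/
structure IsLeafSpace (A : g) (ι : S → Phase g n) (π : S → N) : Prop where
  smooth : ContMDiff 𝓘(𝕜, Fin r → 𝕜) 𝓘(𝕜, Fin k → 𝕜) ∞ π
  surjective : Function.Surjective π
  submersion : ∀ s, Function.Surjective (mfderiv 𝓘(𝕜, Fin r → 𝕜) 𝓘(𝕜, Fin k → 𝕜) π s)
  ker_eq : ∀ s, LinearMap.ker (mfderiv 𝓘(𝕜, Fin r → 𝕜) 𝓘(𝕜, Fin k → 𝕜) π s).toLinearMap =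
    distE A ι s
  fibre : ∀ y, IsConnected (π ⁻¹' {y})

/-- `Q`, immersed in the leaf `S` by `j`, is a submanifold transversal to `E`:
`T_q S = T_q Q ⊕ E_q` at all its points. -/
structure IsTransversal (A : g) (ι : S → Phase g n) (j : Q → S) : Prop where
  smooth : ContMDiff 𝓘(𝕜, Fin d → 𝕜) 𝓘(𝕜, Fin r → 𝕜) ∞ j
  injective : Function.Injective j
  immersion : ∀ q, Function.Injective (mfderiv 𝓘(𝕜, Fin d → 𝕜) 𝓘(𝕜, Fin r → 𝕜) j q)
  isCompl : ∀ q, IsCompl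
    (LinearMap.range (mfderiv 𝓘(𝕜, Fin d → 𝕜) 𝓘(𝕜, Fin r → 𝕜) j q).toLinearMap)
    (distE A ι (j q))

/-- `F`, defined and smooth near `ι s`, is a prolongation of the function `f` on `N = S / E` near
the point `s` of the leaf: it restricts to `f ∘ π` on `S`, and `dF` annihilates `D` along `S`. -/
def IsProlongation (A : g) (ι : S → Phase g n) (π : S → N) (s : S) (f : N → 𝕜)
    (F : Phase g n → 𝕜) : Prop :=
  (∃ U, IsOpen U ∧ ι s ∈ U ∧ ContDiffOn 𝕜 ∞ F U) ∧
    ∀ᶠ t in 𝓝 s, F (ι t) = f (π t) ∧ ∀ V ∈ distD A (ι t), fderiv 𝕜 F (ι t) V = 0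

/-- `b` is the value at `y` of the reduced Poisson bracket `{f, h}_z` on `N = S / E`: at every
point `s` of `S` over `y` it is the value of `{F, H}_z`, for all prolongations `F` of `f` and `H`
of `h`. -/
def IsReducedBracket (A : g) (ι : S → Phase g n) (π : S → N) (z : 𝕜) (f h : N → 𝕜) (y : N)
    (b : 𝕜) : Prop :=
  ∀ s, π s = y → ∀ F H, IsProlongation A ι π s f F → IsProlongation A ι π s h H →
    b = bracket A z F H (ι s)

/-- `Y` is the Hamiltonian vector field on `N = S / E`, with Hamiltonian `f`, of the reduced
Poisson pencil at the value `z` of the parameter: its derivative of any smooth function `h`,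
defined near any point of `N`, is the reduced bracket `{h, f}_z`. -/
def IsReducedHamiltonian (A : g) (ι : S → Phase g n) (π : S → N) (z : 𝕜) (f : N → 𝕜)
    (Y : (y : N) → TangentSpace 𝓘(𝕜, Fin k → 𝕜) y) : Prop :=
  ∀ (y : N) (h : N → 𝕜),
    (∃ U, IsOpen U ∧ y ∈ U ∧ ContMDiffOn 𝓘(𝕜, Fin k → 𝕜) 𝓘(𝕜, 𝕜) ∞ h U) →
      IsReducedBracket A ι π z h f y (mfderiv 𝓘(𝕜, Fin k → 𝕜) 𝓘(𝕜, 𝕜) h y (Y y))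

/-- The vector field `V` on the submanifold `Q` of `S` represents the vector field `Y` on `N`:
the differential of `Q → S → N` maps `V` to `Y`. -/
def Represents (π : S → N) (j : Q → S) (V : (q : Q) → TangentSpace 𝓘(𝕜, Fin d → 𝕜) q)
    (Y : (y : N) → TangentSpace 𝓘(𝕜, Fin k → 𝕜) y) : Prop :=
  ∀ q, mfderiv 𝓘(𝕜, Fin d → 𝕜) 𝓘(𝕜, Fin k → 𝕜) (π ∘ j) q (V q) = Y (π (j q))

/-- The family `V z` of vector fields on `Q` has on the subset `U` the Lax form
`dX(z)/dt_z = [L(z), X(z)]` for all `z`, with `L(z) = ∑_{l ≤ m} z^l B_l` and `B_l : Q → g`. -/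
def HasLaxForm (A : g) (ι : S → Phase g n) (j : Q → S)
    (V : 𝕜 → (q : Q) → TangentSpace 𝓘(𝕜, Fin d → 𝕜) q) (m : ℕ)
    (B : Fin (m + 1) → Q → g) (U : Set Q) : Prop :=
  ∀ z : 𝕜, ∀ q ∈ U, evalTangent (dPhase (ι ∘ j) q (V z q)) z =
    ⁅∑ l : Fin (m + 1), z ^ (l : ℕ) • B l q, laxMatrix A (ι (j q)) z⁆

end Geometry

end MatrixPencil

open MatrixPencil

/-! The engine is the identity `evalTangent_pencil`: for every covector `W`, the vector `P_z W`,
read as a polynomial and evaluated at the same `z`, is `[W_0, X(z)]`. It therefore suffices to write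
the representative `V_z` as `P_z` of a covector.

Let `F` prolong `f_z`. Since `dF` annihilates `D = P_1 (Ker P_0)` and both tensors are skew, `P_1
dF` lies in the range of `P_0`, so `P_z dF` is tangent to `S`; by `IsReducedHamiltonian.eq_mfderiv`
it projects to `Y_z`. Transversality splits it as `V + P_1 ξ` with `V` tangent to `Q` and `P_0 ξ =
0`. The second term lies in `E = Ker dπ`, so `V` represents `Y_z`; and `P_1 ξ = P_z ξ`, so `V = P_z
(dF - ξ)` has Lax form with `L = (dF - ξ)_0`. Splitting each coefficient of `P_z dF` in `z`
separately makes `L` a polynomial in `z`, of degree at most `m + 1` because `P_z` has degree one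
(`IsTransversal.lax_of_decomposition`).

Smoothness is a constant rank matter. Prolongations (`exists_isProlongation`) and decompositions
(`exists_local_lax`) solve linear systems whose kernels have constant dimension, and
`exists_smooth_solution_operator` solves these smoothly over `𝕜`. For a fixed `V` the Lax equation
is affine in the coefficients `B_l`, so a partition of unity glues the local solutions; this is
where only real smoothness survives. -/

namespace MatrixPencil

/-! ### Algebra of the pencil: skewness, annihilators, and the Lax identity. -/

section PencilAlgebra

variable {𝕜 : Type*} [RCLike 𝕜] {p n : ℕ} {g : LieSubalgebra 𝕜 (Matrix (Fin p) (Fin p) 𝕜)}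

/-- The pairing as a bilinear form. -/
noncomputable def pairingForm (g : LieSubalgebra 𝕜 (Matrix (Fin p) (Fin p) 𝕜)) (n : ℕ) :
    LinearMap.BilinForm 𝕜 (Phase g n) :=
  LinearMap.mk₂ 𝕜 pairing
    (fun V V' W => by simp [pairing, add_mul, Finset.sum_add_distrib])
    (fun c V W => by simp [pairing, Finset.mul_sum])
    (fun V W W' => by simp [pairing, mul_add, Finset.sum_add_distrib])
    (fun c V W => by simp [pairing, Finset.mul_sum])

@[simp]
theorem pairingForm_apply (V W : Phase g n) : pairingForm g n V W = pairing V W := rfl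

theorem pairing_comm (V W : Phase g n) : pairing V W = pairing W V :=
  Finset.sum_congr rfl fun _ _ => Matrix.trace_mul_comm _ _

theorem pairingForm_nondegenerate (hg : TraceNondegenerate g) : (pairingForm g n).Nondegenerate := by
  have h : ∀ V : Phase g n, (∀ W, pairing V W = 0) → V = 0 := by
    intro V hV
    funext i
    refine hg _ fun W => ?_
    have h := hV (Pi.single i W)
    rw [pairing, Finset.sum_eq_single i] at h
    · simpa using h
    · intro b _ hb
      simp [Pi.single_eq_of_ne hb]
    · simp
  exact ⟨h, fun V hV => h V fun W => by rw [pairing_comm]; exact hV W⟩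

/-- Invariance of the trace form, by cyclicity: each `ad X` is skew. -/
theorem trace_lie_mul (X V W : g) :
    Matrix.trace ((⁅X, V⁆ : g).1 * W.1) = -Matrix.trace (V.1 * (⁅X, W⁆ : g).1) := by
  simp only [LieSubalgebra.coe_bracket, Ring.lie_def, sub_mul, mul_sub, Matrix.trace_sub]
  rw [mul_assoc, Matrix.trace_mul_comm X.1, ← mul_assoc, ← mul_assoc, mul_assoc V.1 W.1 X.1]
  ring

theorem P0_apply (A : g) (X W : Phase g n) (i : Fin (n + 1)) :
    P0 A X W i = ∑ l : Fin (n + 1), ⁅coeff A X (i + l + 1), W l⁆ := by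
  simp [P0, LinearMap.sum_apply]

theorem P1_apply (A : g) (X W : Phase g n) (i : Fin (n + 1)) :
    P1 A X W i = ∑ l : Fin (n + 1), if i = 0 ∧ l = 0 then -⁅X 0, W l⁆
      else if i = 0 ∨ l = 0 then 0 else ⁅coeff A X (i + l), W l⁆ := by
  simp only [P1, LinearMap.pi_apply, LinearMap.sum_apply, LinearMap.comp_apply, LinearMap.proj_apply]
  refine Finset.sum_congr rfl fun l _ => ?_
  split_ifs <;> simp

/-- The block in position `(i, j)` depends only on `i + j` and is skew, so the whole block matrix is
skew. -/
theorem pairing_P0 (A : g) (X V W : Phase g n) :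
    pairing (P0 A X V) W = -pairing V (P0 A X W) := by
  simp only [pairing, P0_apply, AddSubmonoidClass.coe_finsetSum, Finset.sum_mul, Finset.mul_sum,
    Matrix.trace_sum, ← Finset.sum_neg_distrib]
  rw [Finset.sum_comm]
  refine Finset.sum_congr rfl fun i _ => Finset.sum_congr rfl fun l _ => ?_
  rw [trace_lie_mul, add_comm (l : ℕ)]

theorem pairing_P1 (A : g) (X V W : Phase g n) :
    pairing (P1 A X V) W = -pairing V (P1 A X W) := by
  simp only [pairing, P1_apply, AddSubmonoidClass.coe_finsetSum, Finset.sum_mul, Finset.mul_sum,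
    Matrix.trace_sum, ← Finset.sum_neg_distrib]
  rw [Finset.sum_comm]
  refine Finset.sum_congr rfl fun i _ => Finset.sum_congr rfl fun l _ => ?_
  by_cases hi : i = 0
  · by_cases hl : l = 0
    · simp only [hi, hl, and_self, if_true, NegMemClass.coe_neg, neg_mul, mul_neg, Matrix.trace_neg,
        trace_lie_mul]
    · simp [hi, hl]
  · by_cases hl : l = 0
    · simp [hi, hl]
    · simp only [hi, hl, and_self, or_self, if_false, trace_lie_mul, add_comm (l : ℕ)]

theorem pencil_apply (A : g) (z : 𝕜) (X W : Phase g n) :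
    pencil A z X W = P1 A X W - z • P0 A X W := rfl

/-- An element orthogonal to the kernel of `P_0` lies in its range. -/
theorem mem_range_P0 (hg : TraceNondegenerate g) (A : g) (X V : Phase g n)
    (h : ∀ W ∈ LinearMap.ker (P0 A X), pairing V W = 0) : V ∈ LinearMap.range (P0 A X) := by
  by_contra hV
  -- A linear form that separates `V` from the range is the pairing with some `W`; its vanishing on
  -- the range says, by skewness, that `W` is in the kernel.
  obtain ⟨φ, hφ, hφ'⟩ := Submodule.exists_le_ker_of_notMem hV
  obtain ⟨W, rfl⟩ := ((pairingForm g n).toDual (pairingForm_nondegenerate hg)).surjective φ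
  refine hφ ?_
  simp only [LinearMap.BilinForm.toDual_def, pairingForm_apply]
  rw [pairing_comm]
  refine h W ?_
  rw [LinearMap.mem_ker]
  refine (pairingForm_nondegenerate hg).1 _ fun U => ?_
  have hU := hφ' (LinearMap.mem_range_self (P0 A X) U)
  simp only [LinearMap.mem_ker, LinearMap.BilinForm.toDual_def, pairingForm_apply] at hU ⊢
  rw [pairing_P0, hU, neg_zero]

/-- A covector annihilates `P_1 (Ker P_0)` if and only if `P_1` maps it to the range of `P_0`. -/
theorem P1_mem_range_P0_iff (hg : TraceNondegenerate g) (A : g) (X V : Phase g n) :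
    P1 A X V ∈ LinearMap.range (P0 A X) ↔ ∀ U ∈ distD A X, pairing V U = 0 := by
  constructor
  · rintro ⟨W, hW⟩ U ⟨K, hK, rfl⟩
    have hK : P0 A X K = 0 := hK
    rw [← neg_inj, ← pairing_P1, ← hW, pairing_P0, hK]
    simp [pairing]
  · intro h
    refine mem_range_P0 hg A X _ fun K hK => ?_
    rw [pairing_P1, h _ ⟨K, hK, rfl⟩, neg_zero]

/-- The values of the Poisson pencil at `z` have the Lax form when evaluated at `z`. -/
theorem evalTangent_pencil (A : g) (z : 𝕜) (X W : Phase g n) :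
    evalTangent (pencil A z X W) z = ⁅W 0, laxMatrix A X z⁆ := by
  have h0 : P1 A X W 0 = -⁅X 0, W 0⁆ := by
    rw [P1_apply, Fin.sum_univ_succ]
    simp only [and_self, if_true, true_and, Fin.succ_ne_zero, if_false, true_or,
      Finset.sum_const_zero, add_zero]
  -- Row `i + 1` of `P_1` equals the part of row `i` of `P_0` with column index at least `1`. In
  -- `P_1 - z P_0` these parts cancel after evaluation at `z`, and only the terms in `W 0` survive.
  have hs : ∀ i : Fin n, P1 A X W i.succ =
      ∑ l : Fin n, ⁅coeff A X (i + l + 2), W l.succ⁆ := by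
    intro i
    rw [P1_apply, Fin.sum_univ_succ]
    simp only [Fin.succ_ne_zero, false_and, if_false, or_true, if_true, false_or, zero_add,
      Fin.val_succ]
    refine Finset.sum_congr rfl fun l _ => ?_
    rw [show (i : ℕ) + 1 + (l + 1) = i + l + 2 by ring]
  have hP : ∀ i : Fin (n + 1), P0 A X W i = ⁅coeff A X (i + 1), W 0⁆ +
      ∑ l : Fin n, ⁅coeff A X (i + l + 2), W l.succ⁆ := by
    intro i
    rw [P0_apply, Fin.sum_univ_succ]
    simp only [Fin.val_zero, add_zero, Fin.val_succ]
    refine congrArg _ (Finset.sum_congr rfl fun l _ => ?_)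
    rw [show (i : ℕ) + (l + 1) + 1 = i + l + 2 by ring]
  -- Row `n` of `P_0` has no partner in `P_1`, but its indices exceed `n + 1`, where the
  -- coefficients of `X(λ)` vanish.
  have hlast : ∑ l : Fin n, ⁅coeff A X (n + l + 2), W l.succ⁆ = 0 := by
    refine Finset.sum_eq_zero fun l _ => ?_
    rw [show coeff A X (n + l + 2) = 0 by
      rw [coeff, dif_neg (by omega), if_neg (by omega)], zero_lie]
  have hL : laxMatrix A X z = X 0 + z • ∑ i : Fin (n + 1), z ^ (i : ℕ) • coeff A X (i + 1) := by
    rw [laxMatrix, Fin.sum_univ_succ, Fin.sum_univ_castSucc (n := n)]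
    have h1 : coeff A X (Fin.last n + 1) = A := by simp [coeff]
    have h2 : ∀ i : Fin n, coeff A X (i.castSucc + 1) = X i.succ := by
      intro i
      simp [coeff, Fin.succ]
    rw [h1]
    simp only [h2]
    simp only [smul_add, Finset.smul_sum, smul_smul, Fin.val_zero, pow_zero, one_smul,
      Fin.val_succ, Fin.val_castSucc, Fin.val_last, pow_succ']
    abel
  have hE : evalTangent (P0 A X W) z =
      ⁅∑ i : Fin (n + 1), z ^ (i : ℕ) • coeff A X (i + 1), W 0⁆ +
        ∑ i : Fin n, z ^ (i : ℕ) • ∑ l : Fin n, ⁅coeff A X (i + l + 2), W l.succ⁆ := by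
    simp only [evalTangent, hP, smul_add, Finset.sum_add_distrib, sum_lie, smul_lie]
    rw [Fin.sum_univ_castSucc (n := n)
      (f := fun i => z ^ (i : ℕ) • ∑ l : Fin n, ⁅coeff A X (i + l + 2), W l.succ⁆)]
    simp [hlast]
  have hE1 : evalTangent (P1 A X W) z = -⁅X 0, W 0⁆ +
      z • ∑ i : Fin n, z ^ (i : ℕ) • ∑ l : Fin n, ⁅coeff A X (i + l + 2), W l.succ⁆ := by
    rw [evalTangent, Fin.sum_univ_succ, h0]
    simp only [hs, Fin.val_zero, pow_zero, one_smul, Fin.val_succ, pow_succ', mul_smul,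
      Finset.smul_sum]
  have hsub : evalTangent (pencil A z X W) z =
      evalTangent (P1 A X W) z - z • evalTangent (P0 A X W) z := by
    simp only [evalTangent, pencil_apply, Pi.sub_apply, Pi.smul_apply, smul_sub,
      Finset.sum_sub_distrib, Finset.smul_sum]
    refine congrArg _ (Finset.sum_congr rfl fun i _ => ?_)
    rw [smul_comm]
  rw [hsub, hE, hE1, hL, lie_add, lie_smul, ← lie_skew (X 0), ← lie_skew (W 0) (∑ i : Fin (n + 1), _), smul_add]
  simp only [smul_neg, neg_neg]
  abel

/-- On `Ker P_0` all the tensors `P_z` agree with `P_1`. -/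
theorem pencil_of_mem_ker (A : g) (z : 𝕜) (X : Phase g n) {K : Phase g n} (hK : P0 A X K = 0) :
    pencil A z X K = P1 A X K := by
  rw [pencil_apply, hK, smul_zero, sub_zero]

/-- Nondegeneracy guarantees that the choice made in `gradient` has a candidate. Differentiability
is not needed, as `fderiv` is then the zero form. -/
theorem gradient_spec (hg : TraceNondegenerate g) (F : Phase g n → 𝕜) (X V : Phase g n) :
    fderiv 𝕜 F X V = pairing (gradient F X) V := by
  have : ∃ W : Phase g n, ∀ V, fderiv 𝕜 F X V = pairing W V :=
    ⟨((pairingForm g n).toDual (pairingForm_nondegenerate hg)).symm (fderiv 𝕜 F X).toLinearMap,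
      fun V => by
        rw [← pairingForm_apply, ← LinearMap.BilinForm.toDual_def (pairingForm_nondegenerate hg),
          LinearEquiv.apply_symm_apply]
        rfl⟩
  exact Classical.epsilon_spec this V

theorem gradient_eq (hg : TraceNondegenerate g) (F : Phase g n → 𝕜) (X : Phase g n) :
    gradient F X = ((pairingForm g n).toDual (pairingForm_nondegenerate hg)).symm
      (fderiv 𝕜 F X).toLinearMap := by
  rw [LinearEquiv.eq_symm_apply]
  refine LinearMap.ext fun V => ?_
  exact (gradient_spec hg F X V).symm

/-- The covector that corresponds to a linear form through the pairing, as a continuous linear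
map. -/
noncomputable def ofDual (hg : TraceNondegenerate g) : (Phase g n →L[𝕜] 𝕜) →L[𝕜] Phase g n :=
  LinearMap.toContinuousLinearMap
    (((pairingForm g n).toDual (pairingForm_nondegenerate hg)).symm.toLinearMap ∘ₗ
      LinearMap.toContinuousLinearMap.symm.toLinearMap)

theorem gradient_eq_ofDual (hg : TraceNondegenerate g) (F : Phase g n → 𝕜) (X : Phase g n) :
    gradient F X = ofDual hg (fderiv 𝕜 F X) :=
  gradient_eq hg F X

/-- `P_0` as a family of continuous linear maps. -/
noncomputable def P0L (A : g) (X : Phase g n) : Phase g n →L[𝕜] Phase g n :=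
  LinearMap.toContinuousLinearMap (P0 A X)

/-- `P_1` as a family of continuous linear maps. -/
noncomputable def P1L (A : g) (X : Phase g n) : Phase g n →L[𝕜] Phase g n :=
  LinearMap.toContinuousLinearMap (P1 A X)

@[simp]
theorem P0L_apply (A : g) (X W : Phase g n) : P0L A X W = P0 A X W := rfl

@[simp]
theorem P1L_apply (A : g) (X W : Phase g n) : P1L A X W = P1 A X W := rfl

theorem contDiff_coeff (A : g) (l : ℕ) : ContDiff 𝕜 ∞ fun X : Phase g n => coeff A X l := by
  unfold coeff
  split_ifs
  · exact contDiff_apply 𝕜 g _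
  · exact contDiff_const
  · exact contDiff_const

theorem contDiff_lie {f : Phase g n → g} (hf : ContDiff 𝕜 ∞ f) (W : g) :
    ContDiff 𝕜 ∞ fun X => ⁅f X, W⁆ := by
  have h : (fun X => ⁅f X, W⁆) =
      fun X => -(LinearMap.toContinuousLinearMap (LieAlgebra.ad 𝕜 g W : g →ₗ[𝕜] g)) (f X) := by
    funext X
    rw [← lie_skew]
    rfl
  rw [h]
  exact ((LinearMap.toContinuousLinearMap (LieAlgebra.ad 𝕜 g W : g →ₗ[𝕜] g)).contDiff.comp hf).neg

theorem contDiff_P0L (A : g) : ContDiff 𝕜 ∞ (P0L A : Phase g n → _) := by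
  refine contDiff_clm_apply_iff.2 fun W => contDiff_pi.2 fun i => ?_
  simp only [P0L_apply, P0_apply]
  exact ContDiff.sum fun l _ => contDiff_lie (contDiff_coeff A _) _

theorem contDiff_P1L (A : g) : ContDiff 𝕜 ∞ (P1L A : Phase g n → _) := by
  refine contDiff_clm_apply_iff.2 fun W => contDiff_pi.2 fun i => ?_
  simp only [P1L_apply, P1_apply]
  refine ContDiff.sum fun l _ => ?_
  split_ifs
  · exact (contDiff_lie (contDiff_apply 𝕜 g 0) _).neg
  · exact contDiff_const
  · exact contDiff_lie (contDiff_coeff A _) _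

end PencilAlgebra

end MatrixPencil

/-! ### Smooth solution of linear systems of constant rank. -/

section ConstantRank

variable {𝕜 : Type*} [RCLike 𝕜] {E F : Type*} [NormedAddCommGroup E] [NormedSpace 𝕜 E]
  [FiniteDimensional 𝕜 E] [NormedAddCommGroup F] [NormedSpace 𝕜 F] [FiniteDimensional 𝕜 F]

/-- `G` is a section of `f` over its range, extended arbitrarily to `W`. -/
theorem LinearMap.exists_generalizedInverse {K V W : Type*} [Field K] [AddCommGroup V] [Module K V]
    [AddCommGroup W] [Module K W] (f : V →ₗ[K] W) : ∃ G : W →ₗ[K] V, ∀ x, f (G (f x)) = f x := by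
  obtain ⟨g, hg⟩ := f.rangeRestrict.exists_rightInverse_of_surjective f.range_rangeRestrict
  obtain ⟨G, hG⟩ := LinearMap.exists_extend g
  refine ⟨G, fun x => ?_⟩
  have h1 : G (f x) = g (f.rangeRestrict x) := LinearMap.congr_fun hG (f.rangeRestrict x)
  have h2 := congrArg Subtype.val (LinearMap.congr_fun hg (f.rangeRestrict x))
  rw [h1]
  exact h2

/-- Near a given linear map, the consistent linear systems whose kernel has the same dimension are
solved by an operator that depends smoothly on the system. -/
theorem exists_smooth_solution_operator (M₀ : E →L[𝕜] F) :
    ∃ (O : Set (E →L[𝕜] F)) (R : (E →L[𝕜] F) → F →L[𝕜] E), IsOpen O ∧ M₀ ∈ O ∧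
      ContDiffOn 𝕜 ∞ R O ∧ ∀ M ∈ O,
        Module.finrank 𝕜 (LinearMap.ker M.toLinearMap) =
          Module.finrank 𝕜 (LinearMap.ker M₀.toLinearMap) →
        ∀ b ∈ LinearMap.range M.toLinearMap, M (R M b) = b := by
  have : CompleteSpace E := FiniteDimensional.complete 𝕜 E
  obtain ⟨G', hG'⟩ := M₀.toLinearMap.exists_generalizedInverse
  set G : F →L[𝕜] E := LinearMap.toContinuousLinearMap G'
  have hG : ∀ x, M₀ (G (M₀ x)) = M₀ x := hG'
  -- `T M₀ = 1`, so `T M` is invertible near `M₀`. It maps `ker M` into `ker M₀`, hence onto it when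
  -- the dimensions agree; this makes `R M = (T M)⁻¹ G` a solution operator.
  set T : (E →L[𝕜] F) → E →L[𝕜] E := fun M => 1 + G ∘L (M - M₀) with hT
  have hTs : ContDiff 𝕜 ∞ T :=
    contDiff_const.add (contDiff_const.clm_comp (contDiff_id.sub contDiff_const))
  refine ⟨T ⁻¹' {u | IsUnit u}, fun M => Ring.inverse (T M) ∘L G,
    Units.isOpen.preimage hTs.continuous, by simp [hT], ?_, ?_⟩
  · intro M hM
    obtain ⟨u, hu⟩ := hM
    refine ContDiffAt.contDiffWithinAt (ContDiffAt.clm_comp ?_ contDiffAt_const)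
    have h := contDiffAt_ringInverse (n := ∞) 𝕜 u
    rw [hu] at h
    exact h.comp M hTs.contDiffAt
  · rintro M hM hrank _ ⟨x, rfl⟩
    have h1 : ∀ y, Ring.inverse (T M) (T M y) = y := fun y =>
      DFunLike.congr_fun (Ring.inverse_mul_cancel _ hM) y
    have hTy : ∀ y, T M y = y + G (M y - M₀ y) := fun y => rfl
    have hmaps : (LinearMap.ker M.toLinearMap).map (T M).toLinearMap ≤
        LinearMap.ker M₀.toLinearMap := by
      rintro _ ⟨y, hy, rfl⟩
      have hy : M y = 0 := hy
      change M₀ (T M y) = 0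
      rw [hTy, hy, map_add, zero_sub, map_neg, map_neg, hG, add_neg_cancel]
    have hinj : Function.Injective (T M).toLinearMap := Function.LeftInverse.injective h1
    have heq := Submodule.eq_of_le_of_finrank_eq hmaps
      (((Submodule.equivMapOfInjective _ hinj _).finrank_eq.symm).trans hrank)
    -- Writing this element as `T M y` with `M y = 0` gives `G (M x) = T M (x - y)`, so `R M` sends
    -- `M x` to `x - y`, another preimage of `M x`.
    have hP : x - G (M₀ x) ∈ LinearMap.ker M₀.toLinearMap := by
      change M₀ _ = 0
      rw [map_sub, hG, sub_self]
    rw [← heq] at hP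
    obtain ⟨y, hy, hyx⟩ := hP
    have hy : M y = 0 := hy
    have hyx : T M y = x - G (M₀ x) := hyx
    have hGM : G (M x) = T M (x - y) := by
      rw [map_sub, hyx, hTy, map_sub]
      abel
    change M (Ring.inverse (T M) (G (M x))) = M x
    rw [hGM, h1, map_sub, hy, sub_zero]

end ConstantRank

/-! ### Extending a function with prescribed differential off an immersed submanifold. -/

section Extension

variable {𝕜 : Type*} [RCLike 𝕜] {E F : Type*} [NormedAddCommGroup E] [NormedSpace 𝕜 E]
  [FiniteDimensional 𝕜 E] [NormedAddCommGroup F] [NormedSpace 𝕜 F] [FiniteDimensional 𝕜 F]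

/-- A function and a covector field along an immersed submanifold, compatible with each other, are
near a point the restriction and the differential of a smooth function on the ambient space. -/
theorem exists_extension_with_fderiv {Ω : Set E} (hΩ : IsOpen Ω) {u₀ : E} (hu₀ : u₀ ∈ Ω)
    {i : E → F} (hi : ContDiffOn 𝕜 ∞ i Ω) (hinj : Function.Injective (fderiv 𝕜 i u₀))
    {a : E → 𝕜} (ha : ContDiffOn 𝕜 ∞ a Ω) {β : E → F →L[𝕜] 𝕜} (hβ : ContDiffOn 𝕜 ∞ β Ω)
    (hcomp : ∀ u ∈ Ω, ∀ v, β u (fderiv 𝕜 i u v) = fderiv 𝕜 a u v) :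
    ∃ (Φ : F → 𝕜) (U : Set F), IsOpen U ∧ i u₀ ∈ U ∧ ContDiffOn 𝕜 ∞ Φ U ∧
      ∀ᶠ u in 𝓝 u₀, Φ (i u) = a u ∧ fderiv 𝕜 Φ (i u) = β u := by
  have : CompleteSpace E := FiniteDimensional.complete 𝕜 E
  obtain ⟨W, hW⟩ := (LinearMap.range (fderiv 𝕜 i u₀).toLinearMap).exists_isCompl
  have : CompleteSpace W := FiniteDimensional.complete 𝕜 W
  -- With `W` a complement of the tangent space at `u₀`, `Ψ` is a local diffeomorphism. The
  -- extension is `a u + β u w` in the coordinates `(u, w)`, and `hcomp` makes its differential at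
  -- `(u, 0)` equal to `β u ∘ dΨ`.
  set Ψ : E × W → F := fun p => i p.1 + p.2 with hΨ
  set Ω' : Set (E × W) := Prod.fst ⁻¹' Ω with hΩ'
  have hΩ'o : IsOpen Ω' := hΩ.preimage continuous_fst
  have hfst : Set.MapsTo (Prod.fst : E × W → E) Ω' Ω := fun _ h => h
  have hΨs : ContDiffOn 𝕜 ∞ Ψ Ω' :=
    (hi.comp contDiff_fst.contDiffOn hfst).add
      (W.subtypeL.contDiff.comp contDiff_snd).contDiffOn
  have hΨd : ∀ p ∈ Ω', HasFDerivAt Ψ ((fderiv 𝕜 i p.1).coprod W.subtypeL) p := by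
    intro p hp
    have h1 : HasFDerivAt i (fderiv 𝕜 i p.1) p.1 :=
      ((hi.contDiffAt (hΩ.mem_nhds hp)).differentiableAt (by simp)).hasFDerivAt
    have h2 := (h1.comp p hasFDerivAt_fst).add (W.subtypeL.hasFDerivAt.comp p hasFDerivAt_snd)
    exact h2
  have hp₀ : (u₀, (0 : W)) ∈ Ω' := hu₀
  have hbij : Function.Bijective ((fderiv 𝕜 i u₀).coprod W.subtypeL).toLinearMap := by
    constructor
    · rw [← LinearMap.ker_eq_bot, LinearMap.ker_eq_bot']
      rintro ⟨v, w⟩ h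
      have h : fderiv 𝕜 i u₀ v + w = 0 := h
      have hw : (w : F) ∈ LinearMap.range (fderiv 𝕜 i u₀).toLinearMap :=
        ⟨-v, by rw [map_neg]; exact (eq_neg_of_add_eq_zero_right h).symm⟩
      have hw0 : (w : F) = 0 := Submodule.disjoint_def.1 hW.disjoint _ hw w.2
      rw [hw0, add_zero] at h
      have hv : v = 0 := hinj (h.trans (map_zero _).symm)
      exact Prod.ext hv (Subtype.ext hw0)
    · intro y
      have hy : y ∈ LinearMap.range (fderiv 𝕜 i u₀).toLinearMap ⊔ W := by
        rw [hW.sup_eq_top]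
        exact Submodule.mem_top
      obtain ⟨_, ⟨v, rfl⟩, w, hw, rfl⟩ := Submodule.mem_sup.1 hy
      exact ⟨(v, ⟨w, hw⟩), rfl⟩
  set e₀ : (E × W) ≃L[𝕜] F := (LinearEquiv.ofBijective _ hbij).toContinuousLinearEquiv
  have he₀ : (e₀ : E × W →L[𝕜] F) = (fderiv 𝕜 i u₀).coprod W.subtypeL := by
    ext <;> rfl
  have hΨ₀ : ContDiffAt 𝕜 ∞ Ψ (u₀, 0) := hΨs.contDiffAt (hΩ'o.mem_nhds hp₀)
  have hd₀ : HasFDerivAt Ψ (e₀ : E × W →L[𝕜] F) (u₀, 0) := by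
    rw [he₀]
    exact hΨd _ hp₀
  set P := hΨ₀.toOpenPartialHomeomorph Ψ hd₀ (by simp)
  have hPs : (u₀, (0 : W)) ∈ P.source := hΨ₀.mem_toOpenPartialHomeomorph_source hd₀ (by simp)
  -- Where `dΨ` stays invertible: the inverse has to be smooth on a neighbourhood, not only at the
  -- image of `(u₀, 0)`.
  set I : Set (E × W) := Ω' ∩ fderiv 𝕜 Ψ ⁻¹' Set.range
    ((↑) : ((E × W) ≃L[𝕜] F) → E × W →L[𝕜] F) with hI
  have hIo : IsOpen I :=
    (hΨs.continuousOn_fderiv_of_isOpen hΩ'o (by simp)).isOpen_inter_preimage hΩ'o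
      ContinuousLinearEquiv.isOpen
  have hp₀I : (u₀, (0 : W)) ∈ I := ⟨hp₀, e₀, hd₀.fderiv.symm⟩
  set b : E × W → 𝕜 := fun p => a p.1 + β p.1 p.2 with hb
  have hbs : ContDiffOn 𝕜 ∞ b Ω' :=
    (ha.comp contDiff_fst.contDiffOn hfst).add
      ((hβ.comp contDiff_fst.contDiffOn hfst).clm_apply
        (W.subtypeL.contDiff.comp contDiff_snd).contDiffOn)
  have hsymm : ∀ x ∈ P.target ∩ P.symm ⁻¹' I, ContDiffAt 𝕜 ∞ P.symm x := by
    rintro x ⟨hx, hxΩ, e, he⟩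
    have hd : HasFDerivAt P (e : E × W →L[𝕜] F) (P.symm x) := by
      rw [he]
      exact (hΨd _ hxΩ).differentiableAt.hasFDerivAt
    exact P.contDiffAt_symm hx hd (hΨs.contDiffAt (hΩ'o.mem_nhds hxΩ))
  have hleft : ∀ p ∈ P.source, P.symm (Ψ p) = p := fun p hp => P.left_inv hp
  refine ⟨b ∘ P.symm, P.target ∩ P.symm ⁻¹' I, P.symm.isOpen_inter_preimage hIo, ?_, ?_, ?_⟩
  · have h : Ψ (u₀, 0) = i u₀ := by simp [hΨ]
    rw [← h]
    refine ⟨P.map_source hPs, ?_⟩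
    change P.symm (Ψ (u₀, 0)) ∈ I
    rw [hleft _ hPs]
    exact hp₀I
  · intro x hx
    exact ((hbs.contDiffAt (hΩ'o.mem_nhds hx.2.1)).comp x (hsymm x hx)).contDiffWithinAt
  · have hc : ContinuousAt (fun u : E => (u, (0 : W))) u₀ := by fun_prop
    filter_upwards [hc.preimage_mem_nhds ((P.open_source.inter hIo).mem_nhds ⟨hPs, hp₀I⟩)] with u hu
    obtain ⟨hus, huI⟩ := hu
    have huI' := huI
    obtain ⟨huΩ, e, he⟩ := huI'
    have hiu : Ψ (u, 0) = i u := by simp [hΨ]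
    have hmem : i u ∈ P.target ∩ P.symm ⁻¹' I := by
      rw [← hiu]
      refine ⟨P.map_source hus, ?_⟩
      change P.symm (Ψ (u, 0)) ∈ I
      rwa [hleft _ hus]
    refine ⟨?_, ?_⟩
    · rw [Function.comp_apply, ← hiu, hleft _ hus]
      simp [hb]
    · have hΦ : HasFDerivAt (b ∘ P.symm) (fderiv 𝕜 (b ∘ P.symm) (i u)) (Ψ (u, 0)) := by
        rw [hiu]
        refine (ContDiffAt.differentiableAt (n := ∞) ?_ (by simp)).hasFDerivAt
        refine ContDiffAt.comp _ (hbs.contDiffAt (hΩ'o.mem_nhds hmem.2.1)) (hsymm _ hmem)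
      have h1 := hΦ.comp (u, (0 : W)) (hΨd _ huΩ)
      have h2 : HasFDerivAt b ((fderiv 𝕜 a u).coprod (β u ∘L W.subtypeL)) (u, (0 : W)) := by
        have ha' : HasFDerivAt a (fderiv 𝕜 a u) u :=
          ((ha.contDiffAt (hΩ.mem_nhds huΩ)).differentiableAt (by simp)).hasFDerivAt
        have hβ' : HasFDerivAt β (fderiv 𝕜 β u) u :=
          ((hβ.contDiffAt (hΩ.mem_nhds huΩ)).differentiableAt (by simp)).hasFDerivAt
        have h := (ha'.comp (u, (0 : W)) hasFDerivAt_fst).add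
          ((hβ'.comp (u, (0 : W)) hasFDerivAt_fst).clm_apply
            (W.subtypeL.hasFDerivAt.comp (u, (0 : W)) hasFDerivAt_snd))
        -- The term with the derivative of `β` is applied to `w = 0` and disappears.
        refine HasFDerivAt.congr_fderiv h ?_
        refine ContinuousLinearMap.ext fun y => ?_
        simp
      have h3 : (b ∘ P.symm) ∘ Ψ =ᶠ[𝓝 (u, (0 : W))] b := by
        filter_upwards [P.open_source.mem_nhds hus] with p hp
        rw [Function.comp_apply, Function.comp_apply, hleft p hp]
      have h4 := (h2.congr_of_eventuallyEq h3).unique h1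
      refine ContinuousLinearMap.ext fun y => ?_
      obtain ⟨⟨v, w⟩, rfl⟩ := e.surjective y
      have he' : e (v, w) = fderiv 𝕜 i u v + w := by
        have : (e : E × W →L[𝕜] F) (v, w) = ((fderiv 𝕜 i u).coprod W.subtypeL) (v, w) := by
          rw [he, (hΨd _ huΩ).fderiv]
        simpa using this
      have h5 := (DFunLike.congr_fun h4 (v, w)).symm
      simp only [ContinuousLinearMap.coe_comp, Function.comp_apply,
        ContinuousLinearMap.coprod_apply, Submodule.subtypeL_apply] at h5
      rw [he', h5, map_add, hcomp u huΩ]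

end Extension

/-! ### Differentials on a manifold computed in one fixed chart. -/

section Charts

variable {𝕜 : Type*} [RCLike 𝕜] {E F : Type*} [NormedAddCommGroup E] [NormedSpace 𝕜 E]
  [NormedAddCommGroup F] [NormedSpace 𝕜 F] {M : Type*} [TopologicalSpace M] [ChartedSpace E M]
  [IsManifold 𝓘(𝕜, E) ∞ M]

/-- The differential of a chart at a point of its source. -/
noncomputable def chartDeriv (𝕜 : Type*) [RCLike 𝕜] {E : Type*} [NormedAddCommGroup E]
    [NormedSpace 𝕜 E] {M : Type*} [TopologicalSpace M] [ChartedSpace E M]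
    [IsManifold 𝓘(𝕜, E) ∞ M] {s₀ s : M} (hs : s ∈ (chartAt E s₀).source) :
    TangentSpace 𝓘(𝕜, E) s ≃L[𝕜] E :=
  have : IsManifold 𝓘(𝕜, E) 1 M := IsManifold.of_le (n := ∞) (by simp)
  (mdifferentiable_chart (I := 𝓘(𝕜, E)) s₀).mfderiv hs

/-- `mfderiv` at `s` refers to the preferred chart at `s`, while smooth dependence on `s` has to be
seen in the single chart at `s₀`; `chartDeriv` converts between the two. -/
theorem mfderiv_eq_fderiv_chart {s₀ s : M} (hs : s ∈ (chartAt E s₀).source) {f : M → F}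
    (hf : MDifferentiableAt 𝓘(𝕜, E) 𝓘(𝕜, F) f s) (v : TangentSpace 𝓘(𝕜, E) s) :
    mfderiv 𝓘(𝕜, E) 𝓘(𝕜, F) f s v =
      fderiv 𝕜 (f ∘ (chartAt E s₀).symm) (chartAt E s₀ s) (chartDeriv 𝕜 hs v) := by
  have : IsManifold 𝓘(𝕜, E) 1 M := IsManifold.of_le (n := ∞) (by simp)
  set φ := chartAt E s₀
  have hφ := mdifferentiable_chart (I := 𝓘(𝕜, E)) s₀
  have hsymm : φ.symm (φ s) = s := φ.left_inv hs
  have h1 : MDifferentiableAt 𝓘(𝕜, E) 𝓘(𝕜, F) (f ∘ φ.symm) (φ s) := by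
    refine MDifferentiableAt.comp (φ s) ?_ (hφ.mdifferentiableAt_symm (φ.map_source hs))
    rwa [hsymm]
  have h2 : f =ᶠ[𝓝 s] (f ∘ φ.symm) ∘ φ := by
    filter_upwards [φ.open_source.mem_nhds hs] with x hx
    rw [Function.comp_apply, Function.comp_apply, φ.left_inv hx]
  rw [h2.mfderiv_eq, mfderiv_comp s h1 (hφ.mdifferentiableAt hs), mfderiv_eq_fderiv]
  rfl

theorem contDiffOn_comp_chart_symm (s₀ : M) {O : Set M} {f : M → F}
    (hf : ContMDiffOn 𝓘(𝕜, E) 𝓘(𝕜, F) ∞ f O) :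
    ContDiffOn 𝕜 ∞ (f ∘ (chartAt E s₀).symm)
      ((chartAt E s₀).target ∩ (chartAt E s₀).symm ⁻¹' O) :=
  contMDiffOn_iff_contDiffOn.1
    (hf.comp ((contMDiffOn_chart_symm (I := 𝓘(𝕜, E)) (n := ∞)).mono Set.inter_subset_left)
      Set.inter_subset_right)

end Charts

/-! ### Auxiliary linear algebra and smoothness of precomposition. -/

section LinearAlgebra

theorem Submodule.finrank_map_add_finrank_inf_ker {K V W : Type*} [Field K] [AddCommGroup V]
    [Module K V] [FiniteDimensional K V] [AddCommGroup W] [Module K W] (f : V →ₗ[K] W)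
    (q : Submodule K V) :
    Module.finrank K (q.map f) + Module.finrank K (q ⊓ LinearMap.ker f : Submodule K V) =
      Module.finrank K q := by
  have h := (f.domRestrict q).finrank_range_add_finrank_ker
  rw [LinearMap.range_domRestrict] at h
  have h2 : (LinearMap.ker (f.domRestrict q)).map q.subtype = q ⊓ LinearMap.ker f := by
    ext x
    simp only [Submodule.mem_map, LinearMap.mem_ker, LinearMap.domRestrict_apply,
      Submodule.subtype_apply, Subtype.exists, exists_and_right, exists_eq_right, Submodule.mem_inf]
    constructor
    · rintro ⟨h1, h2⟩
      exact ⟨h1, h2⟩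
    · rintro ⟨h1, h2⟩
      exact ⟨h1, h2⟩
  rw [← h2, Submodule.finrank_map_subtype_eq]
  exact h

end LinearAlgebra

section Precomposition

theorem contDiffOn_compL_flip {𝕜 : Type*} [NontriviallyNormedField 𝕜] {D E F : Type*}
    [NormedAddCommGroup D] [NormedSpace 𝕜 D] [NormedAddCommGroup E] [NormedSpace 𝕜 E]
    [NormedAddCommGroup F] [NormedSpace 𝕜 F] {T : D → E →L[𝕜] F} {Ω : Set D}
    (hT : ContDiffOn 𝕜 ∞ T Ω) (G : Type*) [NormedAddCommGroup G] [NormedSpace 𝕜 G] :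
    ContDiffOn 𝕜 ∞ (fun u => (ContinuousLinearMap.compL 𝕜 E F G).flip (T u)) Ω := by
  have h : ContDiff 𝕜 ∞ fun S => (ContinuousLinearMap.compL 𝕜 E F G).flip S :=
    ContinuousLinearMap.contDiff (F := (F →L[𝕜] G) →L[𝕜] E →L[𝕜] G) _
  exact h.comp_contDiffOn hT

end Precomposition

namespace MatrixPencil

/-! ### The two linear systems, their kernels and their consistency. -/

section Systems

variable {𝕜 : Type*} [RCLike 𝕜] {p n : ℕ} {g : LieSubalgebra 𝕜 (Matrix (Fin p) (Fin p) 𝕜)}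
  {E : Type*} [NormedAddCommGroup E] [NormedSpace 𝕜 E]

/-- The covector of a tuple, as a continuous linear form. -/
noncomputable def toDualL (g : LieSubalgebra 𝕜 (Matrix (Fin p) (Fin p) 𝕜)) (n : ℕ) :
    Phase g n →L[𝕜] Phase g n →L[𝕜] 𝕜 :=
  LinearMap.toContinuousLinearMap
    ((LinearMap.toContinuousLinearMap (𝕜 := 𝕜) (E := Phase g n) (F' := 𝕜)).toLinearMap ∘ₗ
      pairingForm g n)

theorem contDiff_toDualL : ContDiff 𝕜 ∞ fun V : Phase g n => toDualL g n V :=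
  ContinuousLinearMap.contDiff (F := Phase g n →L[𝕜] 𝕜) _

/-- The linear system whose solutions `(β, η)` with right-hand side `(τ, 0)` consist of a covector
`β` that restricts to `τ` along `T` and a witness `η` that `P_1 β` lies in the range of `P_0`. -/
noncomputable def covectorSystem (A : g) (T : E →L[𝕜] Phase g n) (X : Phase g n) :
    (Phase g n × Phase g n) →L[𝕜] (E →L[𝕜] 𝕜) × Phase g n :=
  (ContinuousLinearMap.inl 𝕜 (E →L[𝕜] 𝕜) (Phase g n) ∘L
    (((ContinuousLinearMap.compL 𝕜 E (Phase g n) 𝕜).flip T) ∘L toDualL g n)) ∘L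
      ContinuousLinearMap.fst 𝕜 _ _ +
  ContinuousLinearMap.inr 𝕜 (E →L[𝕜] 𝕜) (Phase g n) ∘L
    (P1L A X ∘L ContinuousLinearMap.fst 𝕜 _ _ - P0L A X ∘L ContinuousLinearMap.snd 𝕜 _ _)

theorem covectorSystem_apply (A : g) (T : E →L[𝕜] Phase g n) (X β η : Phase g n) :
    covectorSystem A T X (β, η) = ((toDualL g n β).comp T, P1 A X β - P0 A X η) := by
  simp [covectorSystem]

/-- The linear system whose solutions `(v, ξ)` with right-hand side `(b, 0)` are the decompositions
`b = T v + P_1 ξ` with `ξ` in the kernel of `P_0`. -/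
noncomputable def decompositionSystem (A : g) (T : E →L[𝕜] Phase g n) (X : Phase g n) :
    (E × Phase g n) →L[𝕜] Phase g n × Phase g n :=
  ContinuousLinearMap.inl 𝕜 (Phase g n) (Phase g n) ∘L
    (T ∘L ContinuousLinearMap.fst 𝕜 _ _ + P1L A X ∘L ContinuousLinearMap.snd 𝕜 _ _) +
  ContinuousLinearMap.inr 𝕜 (Phase g n) (Phase g n) ∘L
    (P0L A X ∘L ContinuousLinearMap.snd 𝕜 _ _)

theorem decompositionSystem_apply (A : g) (T : E →L[𝕜] Phase g n) (X ξ : Phase g n) (v : E) :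
    decompositionSystem A T X (v, ξ) = (T v + P1 A X ξ, P0 A X ξ) := by
  simp [decompositionSystem]

theorem contDiffOn_covectorSystem (A : g) {Ω : Set E} {T : E → E →L[𝕜] Phase g n}
    (hT : ContDiffOn 𝕜 ∞ T Ω) {X : E → Phase g n} (hX : ContDiffOn 𝕜 ∞ X Ω) :
    ContDiffOn 𝕜 ∞ (fun u => covectorSystem A (T u) (X u)) Ω := by
  have h0 : ContDiffOn 𝕜 ∞ (fun u => P0L A (X u)) Ω := (contDiff_P0L A).comp_contDiffOn hX
  have h1 : ContDiffOn 𝕜 ∞ (fun u => P1L A (X u)) Ω := (contDiff_P1L A).comp_contDiffOn hX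
  have h2 : ContDiffOn 𝕜 ∞ (fun u => (ContinuousLinearMap.compL 𝕜 E (Phase g n) 𝕜).flip (T u)) Ω :=
    contDiffOn_compL_flip hT 𝕜
  exact ((contDiffOn_const.clm_comp (h2.clm_comp contDiffOn_const)).clm_comp contDiffOn_const).add
    (contDiffOn_const.clm_comp
      ((h1.clm_comp contDiffOn_const).sub (h0.clm_comp contDiffOn_const)))

theorem contDiffOn_decompositionSystem (A : g) {Ω : Set E} {T : E → E →L[𝕜] Phase g n}
    (hT : ContDiffOn 𝕜 ∞ T Ω) {X : E → Phase g n} (hX : ContDiffOn 𝕜 ∞ X Ω) :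
    ContDiffOn 𝕜 ∞ (fun u => decompositionSystem A (T u) (X u)) Ω := by
  have h0 : ContDiffOn 𝕜 ∞ (fun u => P0L A (X u)) Ω := (contDiff_P0L A).comp_contDiffOn hX
  have h1 : ContDiffOn 𝕜 ∞ (fun u => P1L A (X u)) Ω := (contDiff_P1L A).comp_contDiffOn hX
  exact (contDiffOn_const.clm_comp
      ((hT.clm_comp contDiffOn_const).add (h1.clm_comp contDiffOn_const))).add
    (contDiffOn_const.clm_comp (h0.clm_comp contDiffOn_const))

theorem finrank_distD_add (A : g) (X : Phase g n) :
    Module.finrank 𝕜 (distD A X) +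
      Module.finrank 𝕜 (LinearMap.ker (P0 A X) ⊓ LinearMap.ker (P1 A X) : Submodule 𝕜 _) =
      Module.finrank 𝕜 (LinearMap.ker (P0 A X)) :=
  Submodule.finrank_map_add_finrank_inf_ker _ _

/-- A covector annihilates the range of `P_0` if and only if it lies in the kernel. -/
theorem mem_ker_P0_iff (hg : TraceNondegenerate g) (A : g) (X V : Phase g n) :
    P0 A X V = 0 ↔ ∀ U ∈ LinearMap.range (P0 A X), pairing V U = 0 := by
  constructor
  · rintro h _ ⟨W, rfl⟩
    rw [← neg_inj, ← pairing_P0, h]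
    simp [pairing]
  · intro h
    refine (pairingForm_nondegenerate hg).1 _ fun W => ?_
    rw [pairingForm_apply, pairing_P0, h _ (LinearMap.mem_range_self _ _), neg_zero]

/-- Homogeneous solutions satisfy `P_0 β = 0` and `P_1 β = P_0 η`. For given `β` the choices of `η`
form a translate of `Ker P_0`; the admissible `β` are mapped by `P_1` onto `D ∩ Range P_0`, with
kernel `Ker P_0 ∩ Ker P_1`. All three dimensions turn out to be constant along the leaf. -/
theorem finrank_ker_covectorSystem (hg : TraceNondegenerate g) (A : g) (T : E →L[𝕜] Phase g n)
    (X : Phase g n) (hT : LinearMap.range T.toLinearMap = LinearMap.range (P0 A X)) :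
    Module.finrank 𝕜 (LinearMap.ker (covectorSystem A T X).toLinearMap) =
      Module.finrank 𝕜 (distD A X ⊓ LinearMap.range (P0 A X) : Submodule 𝕜 _) +
      Module.finrank 𝕜 (LinearMap.ker (P0 A X) ⊓ LinearMap.ker (P1 A X) : Submodule 𝕜 _) +
      Module.finrank 𝕜 (LinearMap.ker (P0 A X)) := by
  set K' : Submodule 𝕜 (Phase g n) :=
    LinearMap.ker (P0 A X) ⊓ (LinearMap.range (P0 A X)).comap (P1 A X) with hK'
  have hmem : ∀ β η : Phase g n, (β, η) ∈ LinearMap.ker (covectorSystem A T X).toLinearMap ↔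
      P0 A X β = 0 ∧ P1 A X β = P0 A X η := by
    intro β η
    have h1 : (β, η) ∈ LinearMap.ker (covectorSystem A T X).toLinearMap ↔
        covectorSystem A T X (β, η) = 0 := Iff.rfl
    rw [h1, covectorSystem_apply, Prod.mk_eq_zero, sub_eq_zero, mem_ker_P0_iff hg, ← hT]
    refine and_congr_left fun _ => ⟨?_, ?_⟩
    · rintro h _ ⟨v, rfl⟩
      exact DFunLike.congr_fun h v
    · intro h
      exact ContinuousLinearMap.ext fun v => h _ (LinearMap.mem_range_self T.toLinearMap v)
  have hfst : (LinearMap.ker (covectorSystem A T X).toLinearMap).map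
      (LinearMap.fst 𝕜 (Phase g n) (Phase g n)) = K' := by
    ext β
    constructor
    · rintro ⟨⟨β, η⟩, h, rfl⟩
      obtain ⟨h1, h2⟩ := (hmem _ _).1 h
      exact ⟨h1, ⟨η, h2.symm⟩⟩
    · rintro ⟨h1, ⟨η, h2⟩⟩
      exact ⟨(β, η), (hmem _ _).2 ⟨h1, h2.symm⟩, rfl⟩
  have hker : LinearMap.ker (covectorSystem A T X).toLinearMap ⊓
      LinearMap.ker (LinearMap.fst 𝕜 (Phase g n) (Phase g n)) =
      (LinearMap.ker (P0 A X)).map (LinearMap.inr 𝕜 (Phase g n) (Phase g n)) := by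
    ext ⟨β, η⟩
    constructor
    · rintro ⟨h1, h2⟩
      obtain rfl : β = 0 := h2
      refine ⟨η, ?_, rfl⟩
      have := ((hmem _ _).1 h1).2
      rw [map_zero] at this
      exact this.symm
    · rintro ⟨η', h1, h2⟩
      obtain rfl : (0 : Phase g n) = β := congrArg Prod.fst h2
      obtain rfl : η' = η := congrArg Prod.snd h2
      refine ⟨(hmem _ _).2 ⟨map_zero _, ?_⟩, rfl⟩
      rw [map_zero]
      exact (show P0 A X η' = 0 from h1).symm
  have hK'map : K'.map (P1 A X) = distD A X ⊓ LinearMap.range (P0 A X) := by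
    ext V
    constructor
    · rintro ⟨β, ⟨h1, h2⟩, rfl⟩
      exact ⟨⟨β, h1, rfl⟩, h2⟩
    · rintro ⟨⟨β, h1, rfl⟩, h2⟩
      exact ⟨β, ⟨h1, h2⟩, rfl⟩
  have hK'ker : K' ⊓ LinearMap.ker (P1 A X) =
      LinearMap.ker (P0 A X) ⊓ LinearMap.ker (P1 A X) := by
    ext V
    constructor
    · rintro ⟨⟨h1, _⟩, h2⟩
      exact ⟨h1, h2⟩
    · rintro ⟨h1, h2⟩
      have h3 : P1 A X V = 0 := h2
      refine ⟨Submodule.mem_inf.2 ⟨h1, ?_⟩, h2⟩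
      rw [Submodule.mem_comap, h3]
      exact Submodule.zero_mem _
  rw [← Submodule.finrank_map_add_finrank_inf_ker (LinearMap.fst 𝕜 (Phase g n) (Phase g n)), hfst,
    hker, ← Submodule.finrank_map_add_finrank_inf_ker (P1 A X) K', hK'map, hK'ker,
    ← (Submodule.equivMapOfInjective _ LinearMap.inr_injective _).finrank_eq]

/-- In a homogeneous solution `T v = -P_1 ξ` lies in `D`, so disjointness and injectivity force `v =
0`, and only `ξ` in both kernels remains. -/
theorem finrank_ker_decompositionSystem (A : g) (T : E →L[𝕜] Phase g n)
    (X : Phase g n) (hinj : Function.Injective T)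
    (hT : Disjoint (LinearMap.range T.toLinearMap) (distD A X)) :
    Module.finrank 𝕜 (LinearMap.ker (decompositionSystem A T X).toLinearMap) =
      Module.finrank 𝕜 (LinearMap.ker (P0 A X) ⊓ LinearMap.ker (P1 A X) : Submodule 𝕜 _) := by
  have h : LinearMap.ker (decompositionSystem A T X).toLinearMap =
      (LinearMap.ker (P0 A X) ⊓ LinearMap.ker (P1 A X)).map (LinearMap.inr 𝕜 E (Phase g n)) := by
    ext ⟨v, ξ⟩
    constructor
    · intro h
      have h1 : decompositionSystem A T X (v, ξ) = 0 := h
      rw [decompositionSystem_apply, Prod.mk_eq_zero] at h1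
      obtain ⟨h1, h2⟩ := h1
      have hv : T v ∈ distD A X :=
        ⟨-ξ, by simpa using h2, by rw [map_neg]; exact (eq_neg_of_add_eq_zero_left h1).symm⟩
      have hv0 : T v = 0 := Submodule.disjoint_def.1 hT _ ⟨v, rfl⟩ hv
      rw [hv0, zero_add] at h1
      exact ⟨ξ, ⟨h2, h1⟩, Prod.ext (hinj (hv0.trans (map_zero T).symm)).symm rfl⟩
    · rintro ⟨ξ', ⟨h1, h2⟩, h3⟩
      obtain rfl : (0 : E) = v := congrArg Prod.fst h3
      obtain rfl : ξ' = ξ := congrArg Prod.snd h3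
      have h1 : P0 A X ξ' = 0 := h1
      have h2 : P1 A X ξ' = 0 := h2
      change decompositionSystem A T X (0, ξ') = 0
      rw [decompositionSystem_apply, h1, h2, map_zero, add_zero]
      rfl
  rw [h, ← (Submodule.equivMapOfInjective _ LinearMap.inr_injective _).finrank_eq]

/-- A linear form on `E` that annihilates the vectors mapped to `D` extends along `T` to a covector
that annihilates `D`. -/
theorem mem_range_covectorSystem (hg : TraceNondegenerate g) (A : g) (T : E →L[𝕜] Phase g n)
    (X : Phase g n) (τ : E →L[𝕜] 𝕜) (h : ∀ v, T v ∈ distD A X → τ v = 0) :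
    (τ, 0) ∈ LinearMap.range (covectorSystem A T X).toLinearMap := by
  -- `τ` kills the kernel of the map to the quotient by `D`, hence factors through it; the resulting
  -- form on the quotient, pulled back, is the required covector.
  have hτ : τ.toLinearMap ∈ LinearMap.range ((distD A X).mkQ ∘ₗ T.toLinearMap).dualMap := by
    rw [LinearMap.range_dualMap_eq_dualAnnihilator_ker, Submodule.mem_dualAnnihilator]
    intro v hv
    refine h v ?_
    rw [← Submodule.Quotient.mk_eq_zero]
    exact hv
  obtain ⟨χ, hχ⟩ := hτ
  set β := ((pairingForm g n).toDual (pairingForm_nondegenerate hg)).symm (χ ∘ₗ (distD A X).mkQ)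
  have hβ : ∀ V, pairing β V = χ ((distD A X).mkQ V) := by
    intro V
    rw [← pairingForm_apply, ← LinearMap.BilinForm.toDual_def (pairingForm_nondegenerate hg),
      LinearEquiv.apply_symm_apply]
    rfl
  obtain ⟨η, hη⟩ := (P1_mem_range_P0_iff hg A X β).2 fun U hU => by
    rw [hβ, Submodule.mkQ_apply, (Submodule.Quotient.mk_eq_zero _).2 hU, map_zero]
  refine ⟨(β, η), ?_⟩
  change covectorSystem A T X (β, η) = (τ, 0)
  rw [covectorSystem_apply, hη, sub_self]
  refine Prod.ext (ContinuousLinearMap.ext fun v => ?_) rfl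
  exact (hβ _).trans (LinearMap.congr_fun hχ v)

end Systems

/-! ### Constancy of ranks along the leaf and existence of prolongations. -/

section Leaf

variable {𝕜 : Type*} [RCLike 𝕜] {p n r k : ℕ}
  {g : LieSubalgebra 𝕜 (Matrix (Fin p) (Fin p) 𝕜)} {A : g}
  {S : Type*} [TopologicalSpace S] [ChartedSpace (Fin r → 𝕜) S]
  {N : Type*} [TopologicalSpace N] [ChartedSpace (Fin k → 𝕜) N]
  {ι : S → Phase g n} {π : S → N}

theorem IsSymplecticLeaf.finrank_range_P0 (hS : IsSymplecticLeaf (r := r) A ι) (s : S) :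
    Module.finrank 𝕜 (LinearMap.range (P0 A (ι s))) = r := by
  rw [← hS.tangent s, LinearMap.finrank_range_of_inj (hS.immersion s)]
  exact Module.finrank_fin_fun 𝕜

theorem IsSymplecticLeaf.finrank_ker_P0 (hS : IsSymplecticLeaf (r := r) A ι) (s t : S) :
    Module.finrank 𝕜 (LinearMap.ker (P0 A (ι s))) =
      Module.finrank 𝕜 (LinearMap.ker (P0 A (ι t))) := by
  have h1 := (P0 A (ι s)).finrank_range_add_finrank_ker
  have h2 := (P0 A (ι t)).finrank_range_add_finrank_ker
  rw [hS.finrank_range_P0] at h1 h2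
  omega

theorem IsSymplecticLeaf.map_distE (hS : IsSymplecticLeaf (r := r) A ι) (s : S) :
    (distE A ι s).map (dPhase (r := r) ι s).toLinearMap =
      distD A (ι s) ⊓ LinearMap.range (P0 A (ι s)) := by
  rw [distE, Submodule.map_comap_eq, hS.tangent s, inf_comm]

theorem IsLeafSpace.finrank_distE (hN : IsLeafSpace (r := r) (k := k) A ι π) (s : S) :
    k + Module.finrank 𝕜 (distE (r := r) A ι s) = r := by
  have : FiniteDimensional 𝕜 (TangentSpace 𝓘(𝕜, Fin r → 𝕜) s) :=
    inferInstanceAs (FiniteDimensional 𝕜 (Fin r → 𝕜))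
  have h := (mfderiv 𝓘(𝕜, Fin r → 𝕜) 𝓘(𝕜, Fin k → 𝕜) π s).toLinearMap.finrank_range_add_finrank_ker
  have h1 : Module.finrank 𝕜 (TangentSpace 𝓘(𝕜, Fin r → 𝕜) s) = r := Module.finrank_fin_fun 𝕜
  have h2 : Module.finrank 𝕜 (TangentSpace 𝓘(𝕜, Fin k → 𝕜) (π s)) = k := Module.finrank_fin_fun 𝕜
  rw [LinearMap.range_eq_top.2 (hN.submersion s), finrank_top, h1, h2] at h
  rw [← hN.ker_eq s]
  exact h

/-- The rank of `E` is `r - k` because `E = Ker dπ` and `π` is a submersion. -/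
theorem finrank_distD_inf (hS : IsSymplecticLeaf (r := r) A ι)
    (hN : IsLeafSpace (r := r) (k := k) A ι π) (s t : S) :
    Module.finrank 𝕜 (distD A (ι s) ⊓ LinearMap.range (P0 A (ι s)) : Submodule 𝕜 _) =
      Module.finrank 𝕜 (distD A (ι t) ⊓ LinearMap.range (P0 A (ι t)) : Submodule 𝕜 _) := by
  have h1 := hN.finrank_distE s
  have h2 := hN.finrank_distE t
  rw [← hS.map_distE, ← hS.map_distE,
    ← (Submodule.equivMapOfInjective _ (hS.immersion s) _).finrank_eq,
    ← (Submodule.equivMapOfInjective _ (hS.immersion t) _).finrank_eq]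
  omega

/-- This intersection is the kernel of `P_1` on `Ker P_0`, whose image is `D`. The constant rank of
`D` enters the argument here. -/
theorem finrank_ker_inf_ker (hS : IsSymplecticLeaf (r := r) A ι)
    (hD : ∃ c, ∀ s, Module.finrank 𝕜 (distD A (ι s)) = c) (s t : S) :
    Module.finrank 𝕜 (LinearMap.ker (P0 A (ι s)) ⊓ LinearMap.ker (P1 A (ι s)) : Submodule 𝕜 _) =
      Module.finrank 𝕜
        (LinearMap.ker (P0 A (ι t)) ⊓ LinearMap.ker (P1 A (ι t)) : Submodule 𝕜 _) := by
  obtain ⟨c, hc⟩ := hD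
  have h1 := finrank_distD_add A (ι s)
  have h2 := finrank_distD_add A (ι t)
  rw [hc] at h1 h2
  have h3 := hS.finrank_ker_P0 s t
  omega

variable [IsManifold 𝓘(𝕜, Fin r → 𝕜) ∞ S]

theorem dPhase_eq_fderiv_chart {s₀ s : S} (hs : s ∈ (chartAt (Fin r → 𝕜) s₀).source)
    (hι : ContMDiff 𝓘(𝕜, Fin r → 𝕜) 𝓘(𝕜, Phase g n) ∞ ι) (v : TangentSpace 𝓘(𝕜, Fin r → 𝕜) s) :
    dPhase ι s v = fderiv 𝕜 (ι ∘ (chartAt (Fin r → 𝕜) s₀).symm) (chartAt (Fin r → 𝕜) s₀ s)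
      (chartDeriv 𝕜 hs v) :=
  mfderiv_eq_fderiv_chart hs (hι.mdifferentiable (by simp) s) v

theorem range_fderiv_chart {s₀ s : S} (hs : s ∈ (chartAt (Fin r → 𝕜) s₀).source)
    (hι : ContMDiff 𝓘(𝕜, Fin r → 𝕜) 𝓘(𝕜, Phase g n) ∞ ι) :
    LinearMap.range (fderiv 𝕜 (ι ∘ (chartAt (Fin r → 𝕜) s₀).symm)
      (chartAt (Fin r → 𝕜) s₀ s)).toLinearMap = LinearMap.range (dPhase (r := r) ι s).toLinearMap := by
  ext V
  constructor
  · rintro ⟨v, rfl⟩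
    refine ⟨(chartDeriv 𝕜 hs).symm v, ?_⟩
    refine (dPhase_eq_fderiv_chart hs hι _).trans ?_
    rw [ContinuousLinearEquiv.apply_symm_apply]
    rfl
  · rintro ⟨v, rfl⟩
    exact ⟨chartDeriv 𝕜 hs v, (dPhase_eq_fderiv_chart hs hι v).symm⟩

theorem injective_fderiv_chart {s₀ s : S} (hs : s ∈ (chartAt (Fin r → 𝕜) s₀).source)
    (hι : ContMDiff 𝓘(𝕜, Fin r → 𝕜) 𝓘(𝕜, Phase g n) ∞ ι)
    (h : Function.Injective (dPhase (r := r) ι s)) :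
    Function.Injective (fderiv 𝕜 (ι ∘ (chartAt (Fin r → 𝕜) s₀).symm)
      (chartAt (Fin r → 𝕜) s₀ s)) := by
  intro v w hvw
  obtain ⟨v', rfl⟩ := (chartDeriv 𝕜 hs).surjective v
  obtain ⟨w', rfl⟩ := (chartDeriv 𝕜 hs).surjective w
  rw [h ((dPhase_eq_fderiv_chart hs hι v').trans
    (hvw.trans (dPhase_eq_fderiv_chart hs hι w').symm))]


/-- Every smooth function on the quotient has local prolongations. -/
theorem exists_isProlongation (hg : TraceNondegenerate g) (hS : IsSymplecticLeaf (r := r) A ι)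
    (hD : ∃ c, ∀ s, Module.finrank 𝕜 (distD A (ι s)) = c)
    (hN : IsLeafSpace (r := r) (k := k) A ι π) (s₀ : S) {f : N → 𝕜} {O : Set N} (hO : IsOpen O)
    (hs₀ : π s₀ ∈ O) (hf : ContMDiffOn 𝓘(𝕜, Fin k → 𝕜) 𝓘(𝕜, 𝕜) ∞ f O) :
    ∃ F, IsProlongation A ι π s₀ f F := by
  set φ := chartAt (Fin r → 𝕜) s₀ with hφ
  have hφs₀ : s₀ ∈ φ.source := mem_chart_source _ s₀
  set i := ι ∘ φ.symm with hi_def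
  have hi : ContDiffOn 𝕜 ∞ i φ.target := by
    have := contDiffOn_comp_chart_symm s₀ (contMDiffOn_univ.2 hS.smooth)
    rwa [Set.preimage_univ, Set.inter_univ] at this
  set O' := π ⁻¹' O
  have hO' : IsOpen O' := hO.preimage hN.smooth.continuous
  have hfπ : ContMDiffOn 𝓘(𝕜, Fin r → 𝕜) 𝓘(𝕜, 𝕜) ∞ (f ∘ π) O' :=
    hf.comp hN.smooth.contMDiffOn fun _ h => h
  set a := (f ∘ π) ∘ φ.symm with ha_def
  set Ω₁ := φ.target ∩ φ.symm ⁻¹' O' with hΩ₁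
  have hΩ₁o : IsOpen Ω₁ := φ.symm.isOpen_inter_preimage hO'
  have ha : ContDiffOn 𝕜 ∞ a Ω₁ := contDiffOn_comp_chart_symm s₀ hfπ
  have hT : ContDiffOn 𝕜 ∞ (fderiv 𝕜 i) φ.target := hi.fderiv_of_isOpen φ.open_target (by simp)
  have ha' : ContDiffOn 𝕜 ∞ (fderiv 𝕜 a) Ω₁ := ha.fderiv_of_isOpen hΩ₁o (by simp)
  set M := fun u => covectorSystem A (fderiv 𝕜 i u) (i u) with hM
  have hMs : ContDiffOn 𝕜 ∞ M φ.target := contDiffOn_covectorSystem A hT hi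
  obtain ⟨OM, R, hOM, hM₀, hR, hsol⟩ := exists_smooth_solution_operator (M (φ s₀))
  set Ω := Ω₁ ∩ M ⁻¹' OM with hΩ
  have hMΩ₁ : ContDiffOn 𝕜 ∞ M Ω₁ := hMs.mono Set.inter_subset_left
  have hΩo : IsOpen Ω := hMΩ₁.continuousOn.isOpen_inter_preimage hΩ₁o hOM
  have hu₀ : φ s₀ ∈ Ω := by
    refine ⟨⟨φ.map_source hφs₀, ?_⟩, hM₀⟩
    rw [Set.mem_preimage, φ.left_inv hφs₀]
    exact hs₀
  -- The first component is the future differential of the prolongation: it restricts to `d(f ∘ π)`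
  -- on the leaf, and the second component witnesses that it annihilates `D`.
  set x := fun u => R (M u) (fderiv 𝕜 a u, 0) with hx
  have hxs : ContDiffOn 𝕜 ∞ x Ω :=
    (hR.comp (hMΩ₁.mono Set.inter_subset_left) fun _ h => h.2).clm_apply
      ((ha'.mono Set.inter_subset_left).prodMk contDiffOn_const)
  have hβs : ContDiffOn 𝕜 ∞ (fun u => toDualL g n (x u).1) Ω :=
    contDiff_toDualL.comp_contDiffOn (contDiff_fst.comp_contDiffOn hxs)
  have hrank : ∀ s ∈ φ.source,
      Module.finrank 𝕜 (LinearMap.ker (M (φ s)).toLinearMap) =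
        Module.finrank 𝕜 (LinearMap.ker (M (φ s₀)).toLinearMap) := by
    have h : ∀ s ∈ φ.source, Module.finrank 𝕜 (LinearMap.ker (M (φ s)).toLinearMap) =
        Module.finrank 𝕜 (distD A (ι s) ⊓ LinearMap.range (P0 A (ι s)) : Submodule 𝕜 _) +
        Module.finrank 𝕜
          (LinearMap.ker (P0 A (ι s)) ⊓ LinearMap.ker (P1 A (ι s)) : Submodule 𝕜 _) +
        Module.finrank 𝕜 (LinearMap.ker (P0 A (ι s))) := by
      intro s hs
      have his : i (φ s) = ι s := congrArg ι (φ.left_inv hs)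
      rw [← his]
      refine finrank_ker_covectorSystem hg A (fderiv 𝕜 i (φ s)) (i (φ s)) ?_
      rw [range_fderiv_chart hs hS.smooth, hS.tangent, his]
    intro s hs
    rw [h s hs, h s₀ hφs₀, finrank_distD_inf hS hN s s₀, finrank_ker_inf_ker hS hD s s₀,
      hS.finrank_ker_P0 s s₀]
  have hsolve : ∀ u ∈ Ω, covectorSystem A (fderiv 𝕜 i u) (i u) (x u) = (fderiv 𝕜 a u, 0) := by
    rintro u ⟨⟨huφ, huO⟩, huM⟩
    obtain ⟨s, hs, rfl⟩ : ∃ s ∈ φ.source, φ s = u := ⟨φ.symm u, φ.map_target huφ, φ.right_inv huφ⟩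
    have his : i (φ s) = ι s := congrArg ι (φ.left_inv hs)
    -- Consistency: tangent vectors of the leaf lying in `D` belong to `E = Ker dπ`, where `d(f ∘
    -- π)` vanishes.
    refine hsol _ huM (hrank s hs) _ (mem_range_covectorSystem hg A _ _ _ fun v hv => ?_)
    obtain ⟨w, rfl⟩ := (chartDeriv 𝕜 hs).surjective v
    rw [his, ← dPhase_eq_fderiv_chart hs hS.smooth] at hv
    have huO' : s ∈ O' := by
      have : φ.symm (φ s) ∈ O' := huO
      rwa [φ.left_inv hs] at this
    have hf' : MDifferentiableAt 𝓘(𝕜, Fin k → 𝕜) 𝓘(𝕜, 𝕜) f (π s) :=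
      (hf.contMDiffAt (hO.mem_nhds huO')).mdifferentiableAt (by simp)
    have hπ' : MDifferentiableAt 𝓘(𝕜, Fin r → 𝕜) 𝓘(𝕜, Fin k → 𝕜) π s :=
      hN.smooth.mdifferentiable (by simp) s
    rw [← mfderiv_eq_fderiv_chart hs (hf'.comp s hπ'), mfderiv_comp s hf' hπ']
    have hw : w ∈ LinearMap.ker (mfderiv 𝓘(𝕜, Fin r → 𝕜) 𝓘(𝕜, Fin k → 𝕜) π s).toLinearMap := by
      rw [hN.ker_eq]
      exact hv
    have hw : mfderiv 𝓘(𝕜, Fin r → 𝕜) 𝓘(𝕜, Fin k → 𝕜) π s w = 0 := hw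
    rw [ContinuousLinearMap.comp_apply, hw, map_zero]
    rfl
  have hsolve1 : ∀ u ∈ Ω, ((toDualL g n (x u).1).comp (fderiv 𝕜 i u) = fderiv 𝕜 a u) ∧
      P1 A (i u) (x u).1 = P0 A (i u) (x u).2 := by
    intro u hu
    have h := hsolve u hu
    rw [← Prod.mk.eta (p := x u), covectorSystem_apply, Prod.mk.injEq, sub_eq_zero] at h
    exact h
  obtain ⟨F, U, hU, hsU, hFU, hF⟩ := exists_extension_with_fderiv hΩo hu₀
    (hi.mono (Set.inter_subset_left.trans Set.inter_subset_left))
    (injective_fderiv_chart hφs₀ hS.smooth (hS.immersion s₀))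
    (ha.mono Set.inter_subset_left) hβs
    fun u hu v => DFunLike.congr_fun (hsolve1 u hu).1 v
  have his₀ : i (φ s₀) = ι s₀ := congrArg ι (φ.left_inv hφs₀)
  refine ⟨F, ⟨U, hU, his₀ ▸ hsU, hFU⟩, ?_⟩
  have hφc : ContinuousAt φ s₀ := φ.continuousAt hφs₀
  filter_upwards [hφc.eventually hF, φ.open_source.mem_nhds hφs₀,
    hφc.preimage_mem_nhds (hΩo.mem_nhds hu₀)] with t ht hts htΩ
  have hit : i (φ t) = ι t := congrArg ι (φ.left_inv hts)
  have hat : a (φ t) = f (π t) := congrArg (f ∘ π) (φ.left_inv hts)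
  rw [hit, hat] at ht
  refine ⟨ht.1, fun V hV => ?_⟩
  rw [ht.2]
  have h := (hsolve1 (φ t) htΩ).2
  rw [hit] at h
  exact (P1_mem_range_P0_iff hg A (ι t) _).1 ⟨_, h.symm⟩ V hV

end Leaf

/-! ### Prolongations and the reduced Hamiltonian vector field. -/

section Reduction

variable {𝕜 : Type*} [RCLike 𝕜] {p n r k : ℕ}
  {g : LieSubalgebra 𝕜 (Matrix (Fin p) (Fin p) 𝕜)} {A : g}
  {S : Type*} [TopologicalSpace S] [ChartedSpace (Fin r → 𝕜) S]
  {N : Type*} {ι : S → Phase g n} {π : S → N}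

theorem IsProlongation.eventually {s : S} {f : N → 𝕜} {F : Phase g n → 𝕜}
    (hι : Continuous ι) (h : IsProlongation A ι π s f F) :
    ∀ᶠ t in 𝓝 s, IsProlongation A ι π t f F := by
  obtain ⟨⟨U, hU, hsU, hFU⟩, h⟩ := h
  filter_upwards [h.eventually_nhds, (hU.preimage hι).mem_nhds hsU] with t ht htU
  exact ⟨⟨U, hU, htU, hFU⟩, ht⟩

theorem IsProlongation.differentiableAt {s : S} {f : N → 𝕜} {F : Phase g n → 𝕜}
    (h : IsProlongation A ι π s f F) : DifferentiableAt 𝕜 F (ι s) := by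
  obtain ⟨⟨U, hU, hsU, hFU⟩, -⟩ := h
  exact (hFU.contDiffAt (hU.mem_nhds hsU)).differentiableAt (by simp)

/-- Linear combinations of prolongations are prolongations. -/
theorem IsProlongation.sum {s : S} {σ : Type*} [Fintype σ] (c : σ → 𝕜) {f : σ → N → 𝕜}
    {F : σ → Phase g n → 𝕜} (hι : Continuous ι)
    (h : ∀ l, IsProlongation A ι π s (f l) (F l)) :
    IsProlongation A ι π s (fun y => ∑ l, c l * f l y) (fun X => ∑ l, c l * F l X) := by
  choose U hU hsU hFU using fun l => (h l).1
  refine ⟨⟨⋂ l, U l, isOpen_iInter_of_finite hU, Set.mem_iInter.2 hsU, ?_⟩, ?_⟩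
  · exact ContDiffOn.sum fun l _ => contDiffOn_const.mul ((hFU l).mono (Set.iInter_subset U l))
  · filter_upwards [Filter.eventually_all.2 fun l => (h l).eventually hι] with t ht
    refine ⟨?_, fun V hV => ?_⟩
    · exact Finset.sum_congr rfl fun l _ => by rw [(ht l).2.self_of_nhds.1]
    · have hd : HasFDerivAt (fun X => ∑ l, c l * F l X) (∑ l, c l • fderiv 𝕜 (F l) (ι t)) (ι t) :=
        HasFDerivAt.fun_sum fun l _ => (ht l).differentiableAt.hasFDerivAt.const_mul (c l)
      rw [hd.fderiv, sum_apply]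
      exact Finset.sum_eq_zero fun l _ => by
        rw [smul_apply, (ht l).2.self_of_nhds.2 V hV, smul_zero]

theorem gradient_sum (hg : TraceNondegenerate g) {σ : Type*} [Fintype σ] (c : σ → 𝕜)
    {F : σ → Phase g n → 𝕜} {X : Phase g n} (h : ∀ l, DifferentiableAt 𝕜 (F l) X) :
    gradient (fun X => ∑ l, c l * F l X) X = ∑ l, c l • gradient (F l) X := by
  have hd : HasFDerivAt (fun X => ∑ l, c l * F l X) (∑ l, c l • fderiv 𝕜 (F l) X) X :=
    HasFDerivAt.fun_sum fun l _ => (h l).hasFDerivAt.const_mul (c l)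
  simp only [gradient_eq_ofDual hg]
  rw [hd.fderiv, map_sum]
  simp only [map_smul]

theorem IsProlongation.P1_mem_range (hg : TraceNondegenerate g) {s : S} {f : N → 𝕜}
    {F : Phase g n → 𝕜} (h : IsProlongation A ι π s f F) :
    P1 A (ι s) (gradient F (ι s)) ∈ LinearMap.range (P0 A (ι s)) := by
  refine (P1_mem_range_P0_iff hg A _ _).2 fun U hU => ?_
  rw [← gradient_spec hg]
  exact h.2.self_of_nhds.2 U hU

variable [IsManifold 𝓘(𝕜, Fin r → 𝕜) ∞ S]
  [TopologicalSpace N] [ChartedSpace (Fin k → 𝕜) N] [IsManifold 𝓘(𝕜, Fin k → 𝕜) ∞ N]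

/-- The reduced Hamiltonian vector field is the projection of the Hamiltonian vector field of any
prolongation of the Hamiltonian. -/
theorem IsReducedHamiltonian.eq_mfderiv (hg : TraceNondegenerate g)
    (hS : IsSymplecticLeaf (r := r) A ι)
    (hD : ∃ c, ∀ s, Module.finrank 𝕜 (distD A (ι s)) = c)
    (hN : IsLeafSpace (r := r) (k := k) A ι π) {z : 𝕜} {f : N → 𝕜}
    {Y : (y : N) → TangentSpace 𝓘(𝕜, Fin k → 𝕜) y}
    (hY : IsReducedHamiltonian A ι π z f Y) {s : S} {F : Phase g n → 𝕜}
    (hF : IsProlongation A ι π s f F) {v : TangentSpace 𝓘(𝕜, Fin r → 𝕜) s}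
    (hv : dPhase ι s v = pencil A z (ι s) (gradient F (ι s))) :
    mfderiv 𝓘(𝕜, Fin r → 𝕜) 𝓘(𝕜, Fin k → 𝕜) π s v = Y (π s) := by
  set ψ := chartAt (Fin k → 𝕜) (π s) with hψ
  have hs : π s ∈ ψ.source := mem_chart_source _ _
  refine (chartDeriv 𝕜 hs).injective (funext fun c => ?_)
  -- Vectors on `N` are compared through the coordinate functions of a chart, which is why local
  -- functions `h` must be admitted as test functions.
  let ℓ : (Fin k → 𝕜) →L[𝕜] 𝕜 := ContinuousLinearMap.proj c
  set h : N → 𝕜 := ℓ ∘ ψ with hh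
  have hsm : ContMDiffOn 𝓘(𝕜, Fin k → 𝕜) 𝓘(𝕜, 𝕜) ∞ h ψ.source :=
    ℓ.contDiff.contMDiff.comp_contMDiffOn contMDiffOn_chart
  have hdh : MDifferentiableAt 𝓘(𝕜, Fin k → 𝕜) 𝓘(𝕜, 𝕜) h (π s) :=
    (hsm.contMDiffAt (ψ.open_source.mem_nhds hs)).mdifferentiableAt (by simp)
  have hdh' : ∀ w, mfderiv 𝓘(𝕜, Fin k → 𝕜) 𝓘(𝕜, 𝕜) h (π s) w = chartDeriv 𝕜 hs w c := by
    intro w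
    rw [mfderiv_eq_fderiv_chart hs hdh]
    have he : h ∘ ψ.symm =ᶠ[𝓝 (ψ (π s))] ℓ := by
      filter_upwards [ψ.open_target.mem_nhds (ψ.map_source hs)] with u hu
      exact congrArg ℓ (ψ.right_inv hu)
    rw [he.fderiv_eq, ContinuousLinearMap.fderiv]
    rfl
  -- The hypothesis on `Y` quantifies over all prolongations, so it carries information only because
  -- one exists.
  obtain ⟨H, hH⟩ := exists_isProlongation hg hS hD hN s ψ.open_source hs hsm
  have h1 := hY (π s) h ⟨_, ψ.open_source, hs, hsm⟩ s rfl H F hH hF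
  have hπ : MDifferentiableAt 𝓘(𝕜, Fin r → 𝕜) 𝓘(𝕜, Fin k → 𝕜) π s :=
    hN.smooth.mdifferentiable (by simp) s
  have hι : MDifferentiableAt 𝓘(𝕜, Fin r → 𝕜) 𝓘(𝕜, Phase g n) ι s :=
    hS.smooth.mdifferentiable (by simp) s
  have hHι : H ∘ ι =ᶠ[𝓝 s] h ∘ π := hH.2.mono fun t ht => ht.1
  have h2 : mfderiv 𝓘(𝕜, Fin r → 𝕜) 𝓘(𝕜, 𝕜) (H ∘ ι) s v =
      mfderiv 𝓘(𝕜, Fin r → 𝕜) 𝓘(𝕜, 𝕜) (h ∘ π) s v := by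
    rw [hHι.mfderiv_eq]
    rfl
  rw [mfderiv_comp s hH.differentiableAt.mdifferentiableAt hι, mfderiv_comp s hdh hπ,
    mfderiv_eq_fderiv] at h2
  -- The left side is the bracket `{H, F}_z`, that is `dh (Y)`; the right side is `dh (dπ v)`.
  have h3 : fderiv 𝕜 H (ι s) (dPhase ι s v) =
      mfderiv 𝓘(𝕜, Fin k → 𝕜) 𝓘(𝕜, 𝕜) h (π s)
        (mfderiv 𝓘(𝕜, Fin r → 𝕜) 𝓘(𝕜, Fin k → 𝕜) π s v) := h2
  rw [hv, gradient_spec hg] at h3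
  rw [← hdh', ← hdh', ← h3]
  exact h1.symm

end Reduction

/-! ### Transversal submanifolds and the local Lax representation. -/

section LocalLax

variable {𝕜 : Type*} [RCLike 𝕜] {p n r k d : ℕ}
  {g : LieSubalgebra 𝕜 (Matrix (Fin p) (Fin p) 𝕜)} {A : g}
  {S : Type*} [TopologicalSpace S] [ChartedSpace (Fin r → 𝕜) S]
  {N : Type*} [TopologicalSpace N] [ChartedSpace (Fin k → 𝕜) N]
  {Q : Type*} [TopologicalSpace Q] [ChartedSpace (Fin d → 𝕜) Q]
  {ι : S → Phase g n} {π : S → N} {j : Q → S}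

theorem dPhase_comp (hι : ContMDiff 𝓘(𝕜, Fin r → 𝕜) 𝓘(𝕜, Phase g n) ∞ ι)
    (hj : ContMDiff 𝓘(𝕜, Fin d → 𝕜) 𝓘(𝕜, Fin r → 𝕜) ∞ j) (q : Q)
    (v : TangentSpace 𝓘(𝕜, Fin d → 𝕜) q) :
    dPhase (ι ∘ j) q v = dPhase ι (j q) (mfderiv 𝓘(𝕜, Fin d → 𝕜) 𝓘(𝕜, Fin r → 𝕜) j q v) := by
  have h := mfderiv_comp q (hι.mdifferentiable (by simp) (j q)) (hj.mdifferentiable (by simp) q)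
  exact DFunLike.congr_fun h v

theorem IsTransversal.injective_dPhase (hS : IsSymplecticLeaf (r := r) A ι)
    (hQ : IsTransversal (r := r) (d := d) A ι j) (q : Q) :
    Function.Injective (dPhase (r := d) (ι ∘ j) q) := by
  intro v w h
  rw [dPhase_comp hS.smooth hQ.smooth, dPhase_comp hS.smooth hQ.smooth] at h
  exact hQ.immersion q (hS.immersion (j q) h)

theorem IsTransversal.disjoint_distD (hS : IsSymplecticLeaf (r := r) A ι)
    (hQ : IsTransversal (r := r) (d := d) A ι j) (q : Q) :
    Disjoint (LinearMap.range (dPhase (r := d) (ι ∘ j) q).toLinearMap) (distD A (ι (j q))) := by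
  rw [Submodule.disjoint_def]
  rintro _ ⟨v, rfl⟩ hv
  have hv : dPhase (r := d) (ι ∘ j) q v ∈ distD A (ι (j q)) := hv
  change dPhase (r := d) (ι ∘ j) q v = 0
  rw [dPhase_comp hS.smooth hQ.smooth] at hv ⊢
  have h0 := Submodule.disjoint_def.1 (hQ.isCompl q).disjoint _ (LinearMap.mem_range_self _ v) hv
  have h0 : mfderiv 𝓘(𝕜, Fin d → 𝕜) 𝓘(𝕜, Fin r → 𝕜) j q v = 0 := h0
  rw [h0, map_zero]

/-- A vector tangent to the leaf decomposes along the transversal submanifold and `P_1 (Ker P_0)`. -/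
theorem IsTransversal.exists_decomposition (hS : IsSymplecticLeaf (r := r) A ι)
    (hQ : IsTransversal (r := r) (d := d) A ι j) (q : Q) {V : Phase g n}
    (hV : V ∈ LinearMap.range (P0 A (ι (j q)))) :
    ∃ (v : TangentSpace 𝓘(𝕜, Fin d → 𝕜) q) (ξ : Phase g n),
      dPhase (ι ∘ j) q v + P1 A (ι (j q)) ξ = V ∧ P0 A (ι (j q)) ξ = 0 := by
  rw [← hS.tangent] at hV
  obtain ⟨t, rfl⟩ := hV
  have ht : t ∈ LinearMap.range (mfderiv 𝓘(𝕜, Fin d → 𝕜) 𝓘(𝕜, Fin r → 𝕜) j q).toLinearMap ⊔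
      distE A ι (j q) := by
    rw [(hQ.isCompl q).sup_eq_top]
    exact Submodule.mem_top
  obtain ⟨_, ⟨v, rfl⟩, e, he, rfl⟩ := Submodule.mem_sup.1 ht
  obtain ⟨ξ, hξ, hξe⟩ := he
  refine ⟨v, ξ, ?_, hξ⟩
  rw [dPhase_comp hS.smooth hQ.smooth, hξe]
  exact (map_add (dPhase ι (j q)) _ _).symm

/-- `Ker dπ = E` meets the tangent space of `Q` trivially. This gives uniqueness of the
representative. -/
theorem IsTransversal.injective_mfderiv_comp (hN : IsLeafSpace (r := r) (k := k) A ι π)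
    (hQ : IsTransversal (r := r) (d := d) A ι j) (q : Q) :
    Function.Injective (mfderiv 𝓘(𝕜, Fin d → 𝕜) 𝓘(𝕜, Fin k → 𝕜) (π ∘ j) q) := by
  refine (injective_iff_map_eq_zero _).2 fun v hv => ?_
  rw [mfderiv_comp q (hN.smooth.mdifferentiable (by simp) (j q))
    (hQ.smooth.mdifferentiable (by simp) q)] at hv
  have h1 : mfderiv 𝓘(𝕜, Fin d → 𝕜) 𝓘(𝕜, Fin r → 𝕜) j q v ∈ distE A ι (j q) := by
    rw [← hN.ker_eq]
    exact hv
  have h2 := Submodule.disjoint_def.1 (hQ.isCompl q).disjoint _ (LinearMap.mem_range_self _ v) h1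
  exact hQ.immersion q (Eq.trans h2 (map_zero _).symm)

variable [IsManifold 𝓘(𝕜, Fin r → 𝕜) ∞ S] [IsManifold 𝓘(𝕜, Fin k → 𝕜) ∞ N]

/-- A decomposition of the coefficients of the Hamiltonian vector field along the transversal
submanifold and `P_1 (Ker P_0)` yields the representative of the reduced vector field, in Lax
form. -/
theorem IsTransversal.lax_of_decomposition (hg : TraceNondegenerate g)
    (hS : IsSymplecticLeaf (r := r) A ι)
    (hD : ∃ c, ∀ s, Module.finrank 𝕜 (distD A (ι s)) = c)
    (hN : IsLeafSpace (r := r) (k := k) A ι π) (hQ : IsTransversal (r := r) (d := d) A ι j)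
    {m : ℕ} {f : Fin (m + 1) → N → 𝕜} {z : 𝕜} {Y : (y : N) → TangentSpace 𝓘(𝕜, Fin k → 𝕜) y}
    (hY : IsReducedHamiltonian A ι π z (fun y => ∑ l : Fin (m + 1), z ^ (l : ℕ) * f l y) Y)
    {q : Q} {F : Fin (m + 1) → Phase g n → 𝕜}
    (hP : ∀ l, IsProlongation A ι π (j q) (f l) (F l))
    {W₀ W₁ : Fin (m + 2) → Phase g n}
    (hW₀ : W₀ = Fin.cons (α := fun _ => Phase g n) 0 fun l => gradient (F l) (ι (j q)))
    (hW₁ : W₁ = Fin.snoc (α := fun _ => Phase g n) (fun l => gradient (F l) (ι (j q))) 0)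
    {v : Fin (m + 2) → TangentSpace 𝓘(𝕜, Fin d → 𝕜) q} {ξ : Fin (m + 2) → Phase g n}
    (hv : ∀ l, dPhase (ι ∘ j) q (v l) + P1 A (ι (j q)) (ξ l) =
      P1 A (ι (j q)) (W₁ l) - P0 A (ι (j q)) (W₀ l))
    (hξ : ∀ l, P0 A (ι (j q)) (ξ l) = 0) :
    mfderiv 𝓘(𝕜, Fin d → 𝕜) 𝓘(𝕜, Fin k → 𝕜) (π ∘ j) q
        (∑ l : Fin (m + 2), z ^ (l : ℕ) • v l) = Y (π (j q)) ∧
      evalTangent (dPhase (ι ∘ j) q (∑ l : Fin (m + 2), z ^ (l : ℕ) • v l)) z =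
        ⁅∑ l : Fin (m + 2), z ^ (l : ℕ) • (W₁ l 0 - ξ l 0), laxMatrix A (ι (j q)) z⁆ := by
  set Wz : Phase g n := ∑ l : Fin (m + 1), z ^ (l : ℕ) • gradient (F l) (ι (j q)) with hWz
  -- `W₁` is padded by zero in degree `m + 1` and `W₀` is shifted up by one degree, so that `P_1 W₁
  -- - P_0 W₀` lists the coefficients of `P_z Wz`.
  have hsum₁ : ∑ l : Fin (m + 2), z ^ (l : ℕ) • W₁ l = Wz := by
    rw [Fin.sum_univ_castSucc]
    simp [hW₁, hWz]
  have hsum₀ : ∑ l : Fin (m + 2), z ^ (l : ℕ) • W₀ l = z • Wz := by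
    rw [Fin.sum_univ_succ, hWz, Finset.smul_sum]
    simp [hW₀, pow_succ', mul_smul]
  set ξz : Phase g n := ∑ l : Fin (m + 2), z ^ (l : ℕ) • ξ l with hξz
  set vz : TangentSpace 𝓘(𝕜, Fin d → 𝕜) q := ∑ l : Fin (m + 2), z ^ (l : ℕ) • v l with hvz
  have hξ0 : P0 A (ι (j q)) ξz = 0 := by
    rw [hξz, map_sum]
    exact Finset.sum_eq_zero fun l _ => by rw [map_smul, hξ, smul_zero]
  have hdv : dPhase (ι ∘ j) q vz + P1 A (ι (j q)) ξz = pencil A z (ι (j q)) Wz := by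
    have h1 : dPhase (ι ∘ j) q vz =
        ∑ l : Fin (m + 2), z ^ (l : ℕ) • dPhase (r := d) (ι ∘ j) q (v l) := by
      rw [hvz, map_sum]
      exact Finset.sum_congr rfl fun l _ => map_smul _ _ _
    rw [h1, hξz, map_sum, ← Finset.sum_add_distrib, pencil_apply, ← map_smul, ← hsum₀, ← hsum₁,
      map_sum, map_sum, ← Finset.sum_sub_distrib]
    refine Finset.sum_congr rfl fun l _ => ?_
    rw [map_smul, map_smul, map_smul, ← smul_sub, ← smul_add, hv]
  constructor
  · have hprolz := IsProlongation.sum (fun l : Fin (m + 1) => z ^ (l : ℕ))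
      hS.smooth.continuous hP
    have hgrad : gradient (fun X => ∑ l : Fin (m + 1), z ^ (l : ℕ) * F l X) (ι (j q)) = Wz :=
      gradient_sum hg _ fun l => (hP l).differentiableAt
    have hmem : pencil A z (ι (j q)) Wz ∈ LinearMap.range (P0 A (ι (j q))) := by
      rw [← hgrad, pencil_apply]
      exact Submodule.sub_mem _ (hprolz.P1_mem_range hg)
        (Submodule.smul_mem _ _ (LinearMap.mem_range_self _ _))
    rw [← hS.tangent] at hmem
    obtain ⟨t, ht⟩ := hmem
    have ht : dPhase ι (j q) t = pencil A z (ι (j q)) Wz := ht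
    have h1 := hY.eq_mfderiv hg hS hD hN hprolz (ht.trans (by rw [hgrad]))
    rw [← h1, mfderiv_comp q (hN.smooth.mdifferentiable (by simp) (j q))
      (hQ.smooth.mdifferentiable (by simp) q)]
    -- The Hamiltonian vector and its component along `Q` differ by `P_1 ξz`, which `dπ` does not
    -- see.
    have h2 : t - mfderiv 𝓘(𝕜, Fin d → 𝕜) 𝓘(𝕜, Fin r → 𝕜) j q vz ∈ distE A ι (j q) := by
      have h3 : dPhase ι (j q) (t - mfderiv 𝓘(𝕜, Fin d → 𝕜) 𝓘(𝕜, Fin r → 𝕜) j q vz) =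
          P1 A (ι (j q)) ξz := by
        rw [map_sub, ht, ← hdv, dPhase_comp hS.smooth hQ.smooth]
        exact add_sub_cancel_left _ _
      exact ⟨ξz, hξ0, h3.symm⟩
    rw [← hN.ker_eq] at h2
    have h4 : mfderiv 𝓘(𝕜, Fin r → 𝕜) 𝓘(𝕜, Fin k → 𝕜) π (j q)
      (t - mfderiv 𝓘(𝕜, Fin d → 𝕜) 𝓘(𝕜, Fin r → 𝕜) j q vz) = 0 := h2
    rw [map_sub, sub_eq_zero] at h4
    exact h4.symm
  -- The correction `P_1 ξz` equals `P_z ξz`, so the component along `Q` is again a value of `P_z`.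
  · have h1 : dPhase (ι ∘ j) q vz = pencil A z (ι (j q)) (Wz - ξz) := by
      rw [map_sub, pencil_of_mem_ker A z _ hξ0]
      exact eq_sub_of_add_eq hdv
    rw [h1]
    refine (evalTangent_pencil A z (ι (j q)) (Wz - ξz)).trans ?_
    congr 1
    rw [← hsum₁, hξz, ← Finset.sum_sub_distrib, Finset.sum_apply]
    refine Finset.sum_congr rfl fun l _ => ?_
    rw [← smul_sub]
    rfl

variable [IsManifold 𝓘(𝕜, Fin d → 𝕜) ∞ Q]

/-- Near every point of a transversal submanifold, the reduced Hamiltonian vector fields have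
representatives in Lax form, with coefficients that are smooth over `𝕜`. -/
theorem exists_local_lax (hg : TraceNondegenerate g) (hS : IsSymplecticLeaf (r := r) A ι)
    (hD : ∃ c, ∀ s, Module.finrank 𝕜 (distD A (ι s)) = c)
    (hN : IsLeafSpace (r := r) (k := k) A ι π) (hQ : IsTransversal (r := r) (d := d) A ι j)
    {m : ℕ} {f : Fin (m + 1) → N → 𝕜} (hf : ∀ l, ContMDiff 𝓘(𝕜, Fin k → 𝕜) 𝓘(𝕜, 𝕜) ∞ (f l))
    {Y : 𝕜 → (y : N) → TangentSpace 𝓘(𝕜, Fin k → 𝕜) y}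
    (hY : ∀ z, IsReducedHamiltonian A ι π z (fun y => ∑ l : Fin (m + 1), z ^ (l : ℕ) * f l y) (Y z))
    (q₀ : Q) :
    ∃ U, IsOpen U ∧ q₀ ∈ U ∧ ∃ B : Fin (m + 2) → Q → g,
      (∀ l, ContMDiffOn 𝓘(𝕜, Fin d → 𝕜) 𝓘(𝕜, g) ∞ (B l) U) ∧
      ∀ z : 𝕜, ∀ q ∈ U, ∃ v : TangentSpace 𝓘(𝕜, Fin d → 𝕜) q,
        mfderiv 𝓘(𝕜, Fin d → 𝕜) 𝓘(𝕜, Fin k → 𝕜) (π ∘ j) q v = Y z (π (j q)) ∧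
        evalTangent (dPhase (ι ∘ j) q v) z =
          ⁅∑ l : Fin (m + 2), z ^ (l : ℕ) • B l q, laxMatrix A (ι (j q)) z⁆ := by
  -- Each `f l` is prolonged once, independently of `z`; the same functions are prolongations at all
  -- nearby points of the leaf.
  choose F hF using fun l => exists_isProlongation hg hS hD hN (j q₀) isOpen_univ
    (Set.mem_univ _) (contMDiffOn_univ.2 (hf l))
  choose UF hUFo hUF hFs using fun l => (hF l).1
  set φ := chartAt (Fin d → 𝕜) q₀ with hφ
  have hφq₀ : q₀ ∈ φ.source := mem_chart_source _ q₀
  set i := (ι ∘ j) ∘ φ.symm with hi_def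
  have hιj : ContMDiff 𝓘(𝕜, Fin d → 𝕜) 𝓘(𝕜, Phase g n) ∞ (ι ∘ j) := hS.smooth.comp hQ.smooth
  have hiq : ∀ q ∈ φ.source, i (φ q) = ι (j q) := fun q hq => congrArg (ι ∘ j) (φ.left_inv hq)
  have hi : ContDiffOn 𝕜 ∞ i φ.target := by
    have := contDiffOn_comp_chart_symm q₀ (contMDiffOn_univ.2 hιj)
    rwa [Set.preimage_univ, Set.inter_univ] at this
  -- the differentials of the prolongations, in the chart
  set Ω₁ := φ.target ∩ i ⁻¹' ⋂ l, UF l with hΩ₁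
  have hΩ₁o : IsOpen Ω₁ :=
    hi.continuousOn.isOpen_inter_preimage φ.open_target (isOpen_iInter_of_finite hUFo)
  have hWs : ∀ l, ContDiffOn 𝕜 ∞ (fun u => gradient (F l) (i u)) Ω₁ := by
    intro l
    have h1 : ContDiffOn 𝕜 ∞ (fderiv 𝕜 (F l)) (UF l) :=
      (hFs l).fderiv_of_isOpen (hUFo l) (by simp)
    have h2 : ContDiffOn 𝕜 ∞ (fun u => fderiv 𝕜 (F l) (i u)) Ω₁ :=
      h1.comp (hi.mono Set.inter_subset_left) fun u hu => Set.mem_iInter.1 hu.2 l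
    simp only [gradient_eq_ofDual hg]
    exact (ofDual hg).contDiff.comp_contDiffOn h2
  set W₁ : Fin (m + 2) → (Fin d → 𝕜) → Phase g n :=
    fun l u => Fin.snoc (α := fun _ => Phase g n) (fun l => gradient (F l) (i u)) 0 l with hW₁
  set W₀ : Fin (m + 2) → (Fin d → 𝕜) → Phase g n :=
    fun l u => Fin.cons (α := fun _ => Phase g n) 0 (fun l => gradient (F l) (i u)) l with hW₀
  have hW₁s : ∀ l, ContDiffOn 𝕜 ∞ (W₁ l) Ω₁ := by
    refine Fin.lastCases ?_ fun l => ?_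
    · simp only [hW₁, Fin.snoc_last]
      exact contDiffOn_const
    · simp only [hW₁, Fin.snoc_castSucc]
      exact hWs l
  have hW₀s : ∀ l, ContDiffOn 𝕜 ∞ (W₀ l) Ω₁ := by
    refine Fin.cases ?_ fun l => ?_
    · exact contDiffOn_const
    · exact hWs l
  set b : Fin (m + 2) → (Fin d → 𝕜) → Phase g n :=
    fun l u => P1L A (i u) (W₁ l u) - P0L A (i u) (W₀ l u) with hb
  have hiΩ₁ : ContDiffOn 𝕜 ∞ i Ω₁ := hi.mono Set.inter_subset_left
  have hbs : ∀ l, ContDiffOn 𝕜 ∞ (b l) Ω₁ := fun l =>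
    (((contDiff_P1L A).comp_contDiffOn hiΩ₁).clm_apply (hW₁s l)).sub
      (((contDiff_P0L A).comp_contDiffOn hiΩ₁).clm_apply (hW₀s l))
  -- the decomposition of the coefficients of the Hamiltonian vector field
  have hT : ContDiffOn 𝕜 ∞ (fderiv 𝕜 i) φ.target := hi.fderiv_of_isOpen φ.open_target (by simp)
  set M := fun u => decompositionSystem A (fderiv 𝕜 i u) (i u) with hM
  have hMs : ContDiffOn 𝕜 ∞ M Ω₁ :=
    (contDiffOn_decompositionSystem A hT hi).mono Set.inter_subset_left
  obtain ⟨OM, R, hOM, hM₀, hR, hsol⟩ := exists_smooth_solution_operator (M (φ q₀))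
  set Ω := Ω₁ ∩ M ⁻¹' OM with hΩ
  have hΩo : IsOpen Ω := hMs.continuousOn.isOpen_inter_preimage hΩ₁o hOM
  have hu₀ : φ q₀ ∈ Ω := by
    refine ⟨⟨φ.map_source hφq₀, ?_⟩, hM₀⟩
    rw [Set.mem_preimage, hiq q₀ hφq₀]
    exact Set.mem_iInter.2 hUF
  -- One decomposition for each coefficient in `z`: the solutions `(v_l, ξ_l)` do not depend on `z`.
  set x : Fin (m + 2) → (Fin d → 𝕜) → (Fin d → 𝕜) × Phase g n :=
    fun l u => R (M u) (b l u, 0) with hx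
  have hxs : ∀ l, ContDiffOn 𝕜 ∞ (x l) Ω := fun l =>
    (hR.comp (hMs.mono Set.inter_subset_left) fun _ h => h.2).clm_apply
      (((hbs l).mono Set.inter_subset_left).prodMk contDiffOn_const)
  have hrank : ∀ q ∈ φ.source,
      Module.finrank 𝕜 (LinearMap.ker (M (φ q)).toLinearMap) =
        Module.finrank 𝕜 (LinearMap.ker (M (φ q₀)).toLinearMap) := by
    have h : ∀ q ∈ φ.source, Module.finrank 𝕜 (LinearMap.ker (M (φ q)).toLinearMap) =
        Module.finrank 𝕜 (LinearMap.ker (P0 A (ι (j q))) ⊓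
          LinearMap.ker (P1 A (ι (j q))) : Submodule 𝕜 _) := by
      intro q hq
      rw [← hiq q hq]
      refine finrank_ker_decompositionSystem A (fderiv 𝕜 i (φ q)) (i (φ q)) ?_ ?_
      · exact injective_fderiv_chart hq hιj (hQ.injective_dPhase hS q)
      · rw [range_fderiv_chart hq hιj, hiq q hq]
        exact hQ.disjoint_distD hS q
    intro q hq
    rw [h q hq, h q₀ hφq₀, finrank_ker_inf_ker hS hD (j q) (j q₀)]
  have hprol : ∀ᶠ q in 𝓝 q₀, ∀ l, IsProlongation A ι π (j q) (f l) (F l) :=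
    hQ.smooth.continuous.continuousAt.eventually
      (Filter.eventually_all.2 fun l => (hF l).eventually hS.smooth.continuous)
  obtain ⟨UP, hUP, hUPo, hqUP⟩ := eventually_nhds_iff.1 hprol
  refine ⟨(φ.source ∩ φ ⁻¹' Ω) ∩ UP, (φ.isOpen_inter_preimage hΩo).inter hUPo,
    ⟨⟨hφq₀, hu₀⟩, hqUP⟩, fun l q => W₁ l (φ q) 0 - (x l (φ q)).2 0, fun l => ?_, ?_⟩
  · have h1 : ContDiffOn 𝕜 ∞ (fun u => W₁ l u 0 - (x l u).2 0) Ω :=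
      ((contDiff_apply 𝕜 g (0 : Fin (n + 1))).comp_contDiffOn
        ((hW₁s l).mono Set.inter_subset_left)).sub
      ((contDiff_apply 𝕜 g (0 : Fin (n + 1))).comp_contDiffOn
        (contDiff_snd.comp_contDiffOn (hxs l)))
    have h2 : ContMDiffOn 𝓘(𝕜, Fin d → 𝕜) 𝓘(𝕜, Fin d → 𝕜) ∞ φ φ.source := contMDiffOn_chart
    exact h1.contMDiffOn.comp
      (h2.mono (Set.inter_subset_left.trans Set.inter_subset_left)) fun _ h => h.1.2
  · rintro z q ⟨⟨hq, hqΩ⟩, hqP⟩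
    have hPq := hUP q hqP
    have hbmem : ∀ l, b l (φ q) ∈ LinearMap.range (P0 A (ι (j q))) := by
      intro l
      simp only [hb, hiq q hq]
      refine Submodule.sub_mem _ ?_ (LinearMap.mem_range_self _ _)
      refine Fin.lastCases ?_ (fun l => ?_) l
      · simp only [hW₁, Fin.snoc_last, map_zero]
        exact Submodule.zero_mem _
      · simp only [hW₁, Fin.snoc_castSucc, hiq q hq]
        exact (hPq l).P1_mem_range hg
    have hxsol : ∀ l, fderiv 𝕜 i (φ q) (x l (φ q)).1 + P1 A (ι (j q)) (x l (φ q)).2 = b l (φ q) ∧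
        P0 A (ι (j q)) (x l (φ q)).2 = 0 := by
      intro l
      obtain ⟨v, ξ, h1, h2⟩ := hQ.exists_decomposition hS q (hbmem l)
      have hmem : (b l (φ q), (0 : Phase g n)) ∈ LinearMap.range (M (φ q)).toLinearMap := by
        refine ⟨(chartDeriv 𝕜 hq v, ξ), ?_⟩
        refine (decompositionSystem_apply A _ _ _ _).trans ?_
        rw [hiq q hq, h2, ← h1]
        exact congrArg (fun V => (V + P1 A (ι (j q)) ξ, (0 : Phase g n)))
          (dPhase_eq_fderiv_chart hq hιj v).symm
      have h := hsol _ hqΩ.2 (hrank q hq) _ hmem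
      have h : M (φ q) ((x l (φ q)).1, (x l (φ q)).2) = (b l (φ q), 0) := h
      rw [hM, decompositionSystem_apply, Prod.mk.injEq, hiq q hq] at h
      exact h
    obtain ⟨h1, h2⟩ := hQ.lax_of_decomposition hg hS hD hN (hY z) hPq
      (W₀ := fun l => W₀ l (φ q)) (W₁ := fun l => W₁ l (φ q))
      (v := fun l => (chartDeriv 𝕜 hq).symm (x l (φ q)).1) (ξ := fun l => (x l (φ q)).2)
      (by simp only [hW₀, hiq q hq]) (by simp only [hW₁, hiq q hq])
      (fun l => by
        rw [dPhase_eq_fderiv_chart hq hιj, ContinuousLinearEquiv.apply_symm_apply]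
        refine (hxsol l).1.trans ?_
        simp only [hb, hiq q hq, P0L_apply, P1L_apply]) (fun l => (hxsol l).2)
    exact ⟨_, h1, h2⟩

end LocalLax

end MatrixPencil

/-! ### Passage to real smoothness. -/

section RestrictScalars

variable {𝕜 : Type*} [RCLike 𝕜] {E F : Type*} [NormedAddCommGroup E] [NormedSpace 𝕜 E]
  [NormedSpace ℝ E] [IsScalarTower ℝ 𝕜 E] [NormedAddCommGroup F] [NormedSpace 𝕜 F]
  [NormedSpace ℝ F] [IsScalarTower ℝ 𝕜 F] {M : Type*} [TopologicalSpace M] [ChartedSpace E M]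

variable (𝕜 E M) in
/-- A manifold over `𝕜` is a manifold over `ℝ`. -/
theorem IsManifold.restrictScalars_real [IsManifold 𝓘(𝕜, E) ∞ M] : IsManifold 𝓘(ℝ, E) ∞ M := by
  refine isManifold_of_contDiffOn _ _ _ fun e e' he he' => ?_
  have h := (HasGroupoid.compatible (G := contDiffGroupoid ∞ 𝓘(𝕜, E)) he he')
  exact (mem_groupoid_of_pregroupoid.1 h).1.restrict_scalars ℝ

theorem ContMDiffOn.restrictScalars_real {f : M → F} {s : Set M}
    (hf : ContMDiffOn 𝓘(𝕜, E) 𝓘(𝕜, F) ∞ f s) : ContMDiffOn 𝓘(ℝ, E) 𝓘(ℝ, F) ∞ f s := by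
  intro x hx
  have h := (contMDiffWithinAt_iff.1 (hf x hx))
  exact contMDiffWithinAt_iff.2 ⟨h.1, h.2.restrict_scalars ℝ⟩

end RestrictScalars

/-! ### Uniqueness of the representative and gluing of the local Lax forms. -/

theorem mainTheorem3 {𝕜 : Type*} [RCLike 𝕜] {p n r k d : ℕ}
    {g : LieSubalgebra 𝕜 (Matrix (Fin p) (Fin p) 𝕜)} (hg : TraceNondegenerate g) (A : g)
    -- the symplectic leaf `S` of `P_0`
    {S : Type*} [TopologicalSpace S] [ChartedSpace (Fin r → 𝕜) S]
    [IsManifold 𝓘(𝕜, Fin r → 𝕜) ∞ S]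
    (ι : S → Phase g n) (hS : IsSymplecticLeaf (r := r) A ι)
    -- `D` has constant rank along `S`
    (hD : ∃ c, ∀ s, Module.finrank 𝕜 (distD A (ι s)) = c)
    -- the quotient manifold `N = S / E`
    {N : Type*} [TopologicalSpace N] [ChartedSpace (Fin k → 𝕜) N]
    [IsManifold 𝓘(𝕜, Fin k → 𝕜) ∞ N]
    (π : S → N) (hN : IsLeafSpace (r := r) (k := k) A ι π)
    -- the transversal submanifold `Q` of `S`
    {Q : Type*} [TopologicalSpace Q] [T2Space Q] [SecondCountableTopology Q]
    [ChartedSpace (Fin d → 𝕜) Q] [IsManifold 𝓘(𝕜, Fin d → 𝕜) ∞ Q]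
    (j : Q → S) (hQ : IsTransversal (r := r) (d := d) A ι j)
    -- the Hamiltonian `f_0 + z f_1 + … + z^m f_m` on `N`, and its Hamiltonian vector fields `Y z`
    (m : ℕ) (f : Fin (m + 1) → N → 𝕜)
    (hf : ∀ l, ContMDiff 𝓘(𝕜, Fin k → 𝕜) 𝓘(𝕜, 𝕜) ∞ (f l))
    (Y : 𝕜 → (y : N) → TangentSpace 𝓘(𝕜, Fin k → 𝕜) y)
    (hY : ∀ z, IsReducedHamiltonian A ι π z (fun y => ∑ l : Fin (m + 1), z ^ (l : ℕ) * f l y) (Y z)) :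
    ∃ V : 𝕜 → (q : Q) → TangentSpace 𝓘(𝕜, Fin d → 𝕜) q,
      -- `V z` is the unique representative on `Q` of `Y z`
      (∀ z V', Represents π j V' (Y z) ↔ V' = V z) ∧
      -- a global Lax representation with smooth coefficients
      (∃ B : Fin (m + 2) → Q → g,
        (∀ l, ContMDiff 𝓘(ℝ, Fin d → 𝕜) 𝓘(ℝ, g) ∞ (B l)) ∧
        HasLaxForm A ι j V (m + 1) B Set.univ) ∧
      -- near every point the coefficients can be chosen smooth over `𝕜` (holomorphic, if `𝕜 = ℂ`)
      ∀ q : Q, ∃ U, IsOpen U ∧ q ∈ U ∧ ∃ B : Fin (m + 2) → Q → g,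
        (∀ l, ContMDiffOn 𝓘(𝕜, Fin d → 𝕜) 𝓘(𝕜, g) ∞ (B l) U) ∧
        HasLaxForm A ι j V (m + 1) B U := by
  have hloc := exists_local_lax hg hS hD hN hQ hf hY
  have hex : ∀ (z : 𝕜) (q : Q), ∃ v : TangentSpace 𝓘(𝕜, Fin d → 𝕜) q,
      mfderiv 𝓘(𝕜, Fin d → 𝕜) 𝓘(𝕜, Fin k → 𝕜) (π ∘ j) q v = Y z (π (j q)) := by
    intro z q
    obtain ⟨U, -, hq, B, -, hB⟩ := hloc q
    obtain ⟨v, hv, -⟩ := hB z q hq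
    exact ⟨v, hv⟩
  choose V hV using hex
  have huniq : ∀ (z : 𝕜) (q : Q) (v : TangentSpace 𝓘(𝕜, Fin d → 𝕜) q),
      mfderiv 𝓘(𝕜, Fin d → 𝕜) 𝓘(𝕜, Fin k → 𝕜) (π ∘ j) q v = Y z (π (j q)) → v = V z q :=
    fun z q v hv => hQ.injective_mfderiv_comp hN q (hv.trans (hV z q).symm)
  have hlocV : ∀ q : Q, ∃ U, IsOpen U ∧ q ∈ U ∧ ∃ B : Fin (m + 2) → Q → g,
      (∀ l, ContMDiffOn 𝓘(𝕜, Fin d → 𝕜) 𝓘(𝕜, g) ∞ (B l) U) ∧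
      HasLaxForm A ι j V (m + 1) B U := by
    intro q₀
    obtain ⟨U, hU, hq, B, hBs, hB⟩ := hloc q₀
    refine ⟨U, hU, hq, B, hBs, fun z q hq => ?_⟩
    obtain ⟨v, hv, hlax⟩ := hB z q hq
    -- The local vectors are values of the one field `V`, so all local coefficient families solve
    -- the same equation.
    rw [← huniq z q v hv]
    exact hlax
  refine ⟨V, fun z V' => ⟨fun h => funext fun q => huniq z q _ (h q), ?_⟩, ?_, hlocV⟩
  · rintro rfl
    exact hV z
  have := IsManifold.restrictScalars_real 𝕜 (Fin d → 𝕜) Q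
  have : LocallyCompactSpace Q := ChartedSpace.locallyCompactSpace (Fin d → 𝕜) Q
  -- The admissible coefficients at `q`, for all `z` at once. The equations are affine in `B`, so
  -- this set is convex, and a real partition of unity glues local smooth sections of it.
  set t : Q → Set (Fin (m + 2) → g) := fun q => {B | ∀ z : 𝕜,
    evalTangent (dPhase (ι ∘ j) q (V z q)) z =
      ⁅∑ l : Fin (m + 2), z ^ (l : ℕ) • B l, laxMatrix A (ι (j q)) z⁆} with ht
  have htc : ∀ q, Convex ℝ (t q) := by
    intro q B hB B' hB' a b _ _ hab z
    have h : ∑ l : Fin (m + 2), z ^ (l : ℕ) • (a • B + b • B') l =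
        (a : 𝕜) • (∑ l : Fin (m + 2), z ^ (l : ℕ) • B l) +
          (b : 𝕜) • ∑ l : Fin (m + 2), z ^ (l : ℕ) • B' l := by
      rw [Finset.smul_sum, Finset.smul_sum, ← Finset.sum_add_distrib]
      refine Finset.sum_congr rfl fun l _ => ?_
      rw [Pi.add_apply, Pi.smul_apply, Pi.smul_apply, smul_add, smul_comm (a : 𝕜),
        smul_comm (b : 𝕜), RCLike.real_smul_eq_coe_smul (K := 𝕜) a,
        RCLike.real_smul_eq_coe_smul (K := 𝕜) b]
    rw [h, add_lie, smul_lie, smul_lie, ← hB z, ← hB' z, ← add_smul, ← RCLike.ofReal_add, hab,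
      RCLike.ofReal_one, one_smul]
  obtain ⟨B, hB⟩ := exists_contMDiffMap_forall_mem_convex_of_local (n := (⊤ : ℕ∞))
    𝓘(ℝ, Fin d → 𝕜) htc fun q₀ => by
      obtain ⟨U, hU, hq, B, hBs, hB⟩ := hlocV q₀
      refine ⟨U, hU.mem_nhds hq, fun q l => B l q, ?_, fun q hq z => hB z q hq⟩
      exact contMDiffOn_pi_space.2 fun l => (hBs l).restrictScalars_real
  refine ⟨fun l q => B q l, fun l => ?_, fun z q _ => hB q z⟩
  exact contMDiff_pi_space.1 B.contMDiff l
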